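/- **Setting.** Let $(\Omega,\mathcal F,P)$ be a probability space carrying random variables $x_t\in\mathbb R^N$ (state), $w_t\in\mathbb R^d$ (noise), $q_t\in\mathcal M$ and $q'_t\in\mathcal M'$ (channel input and output, with $\mathcal M,\mathcal M'$ finite), $t=0,1,2,\dots$, such that: * the $w_t$ are i.i.d. with law $\nu$, and $(w_t)_{t\ge0}$ is independent of $x_0$; * (plant) $x_{t+1}=f(x_t,w_t)+Bu_t$ with $u_t\in\mathbb R^s$ and $B\in\mathbb R^{N\times s}$, where $f:\mathbb R^N\times\mathbb R^d\to\mathbb R^N$ is Borel measurable and, for every $w$, the map $f(\cdot,w):\mathbb R^N\to\mathbb R^N$ is continuously differentiable and invertible (bijective); * (admissible coding and control policy) $q_t=\gamma^e_t(x_{[0,t]},q'_{[0,t-1]})$ and $u_t=\gamma_t(q'_{[0,t]})$ for measurable functions $\gamma^e_t,\gamma_t$, where $a_{[0,t]}=(a_0,\dots,a_t)$; * (channel) for every $t$ the conditional law of $q'_t$ given $q_{[0,t]},q'_{[0,t-1]},x_0,(w_r)_{r\ge0}$ is $\kappa_t(\,\cdot\mid q_{[0,t]},q'_{[0,t-1]})$,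 for given probability kernels $\kappa_t$; that is, the channel is arbitrary with memory and feedback, and depends on $x_0$ and $(w_r)$ only through its inputs and past outputs. **Notation.** Let $\pi_t$ be the law of $x_t$, and let $h(x_t)\in[-\infty,\infty]$ be its differential entropy $-\int p_t\log_2 p_t\,dx$ if $\pi_t$ has a Lebesgue density $p_t$, and $-\infty$ otherwise. The directed information is $$I(q_{[0,T-1]}\to q'_{[0,T-1]})=I(q_0;q'_0)+\sum_{t=1}^{T-1}I(q_{[0,t]};q'_t\mid q'_{[0,t-1]})$$ (in bits), and $|J(f(x,w))|$ is the absolute value of the determinant of the Jacobian matrix of $f(\cdot,w)$ at $x$, with $\log_2 0=-\infty$. Integrals of extended-real functions are $\int g^+-\int g^-$ with values in $[-\infty,\infty]$; in integrals and in sums, $\infty-\infty$ is read as $-\infty$. **Theorem (generalized Bode integral formula).** Suppose that $h(x_0)$ is finite and that $$\limsup_{t\to\infty}\frac{h(x_t)}{t}\le 0 .$$ Then $$\limsup_{T\to\infty}\frac1T\,I(q_{[0,T-1]}\to q'_{[0,T-1]})\;\ge\;\limsup_{T\to\infty}\frac1T\sum_{t=0}^{T-1}\iint\log_2|J(f(x,w))|\;(\pi_t\otimes\nu)(dx,dw).$$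 -/

import Mathlib

open MeasureTheory ProbabilityTheory Filter

namespace BodeFormula

noncomputable section

/-- The Euclidean space `ℝⁿ` with its Borel structure and Lebesgue measure. -/
abbrev Vec (n : ℕ) : Type := EuclideanSpace ℝ (Fin n)

/-- The integral `∫ g⁺ dμ - ∫ g⁻ dμ` of an extended-real function, with value in `[-∞, ∞]`.
It is the usual integral as soon as one of the two parts is finite; if both are infinite
the value is `-∞` (the `EReal` convention `⊤ - ⊤ = ⊥`). -/
def extIntegral {α : Type*} [MeasurableSpace α] (μ : Measure α) (g : α → EReal) : EReal :=
  ((∫⁻ a, (g a).toENNReal ∂μ : ENNReal) : EReal) -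
    ((∫⁻ a, (-(g a)).toENNReal ∂μ : ENNReal) : EReal)

/-- `log₂ |y|`, with the value `-∞` at `y = 0`. -/
def log2Abs (y : ℝ) : EReal :=
  open Classical in if y = 0 then ⊥ else ((Real.logb 2 |y| : ℝ) : EReal)

/-- Differential entropy in bits, `-∫ p log₂ p dx` with `p` the Lebesgue density of `μ`.
A law that is not absolutely continuous has differential entropy `-∞`. -/
def diffEntropy {n : ℕ} (μ : Measure (Vec n)) : EReal :=
  open Classical in
  if μ ≪ (volume : Measure (Vec n)) then
    extIntegral (volume : Measure (Vec n)) fun y =>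
      ((Real.negMulLog (μ.rnDeriv volume y).toReal / Real.log 2 : ℝ) : EReal)
  else ⊥

section Discrete

variable {Ω : Type*} [MeasurableSpace Ω]

/-- Shannon entropy `H(X) = -∑ p(s) log₂ p(s)` of a finitely valued random variable. -/
def entropy {S : Type*} [Fintype S] (P : Measure Ω) (X : Ω → S) : ℝ :=
  ∑ s, Real.negMulLog (P.real (X ⁻¹' {s})) / Real.log 2

/-- Conditional entropy `H(X | Z) = ∑ P(Z = z) H(X | Z = z)`. -/
def condEntropy {S U : Type*} [Fintype S] [Fintype U] (P : Measure Ω)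
    (X : Ω → S) (Z : Ω → U) : ℝ :=
  ∑ z, P.real (Z ⁻¹' {z}) * entropy (ProbabilityTheory.cond P (Z ⁻¹' {z})) X

/-- Conditional mutual information `I(X; Y | Z) = H(X | Z) - H(X | Y, Z)`. -/
def condMutualInfo {S S' U : Type*} [Fintype S] [Fintype S'] [Fintype U] (P : Measure Ω)
    (X : Ω → S) (Y : Ω → S') (Z : Ω → U) : ℝ :=
  condEntropy P X Z - condEntropy P X fun ω => (Y ω, Z ω)

/-- The first `t` terms `(a₀, …, a_{t-1})` of a random sequence. -/
def history {S : Type*} (a : ℕ → Ω → S) (t : ℕ) (ω : Ω) : Fin t → S := fun i => a i ω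

/-- Directed information
`I(q_{[0,T-1]} → q'_{[0,T-1]}) = ∑_{t < T} I(q_{[0,t]}; q'_t | q'_{[0,t-1]})`. In the term
`t = 0` the conditioning variable is the empty tuple, so that this term is `I(q₀; q'₀)`. -/
def directedInfo {M M' : Type*} [Fintype M] [Fintype M'] (P : Measure Ω)
    (q : ℕ → Ω → M) (q' : ℕ → Ω → M') (T : ℕ) : ℝ :=
  ∑ t ∈ Finset.range T, condMutualInfo P (history q (t + 1)) (q' t) (history q' t)

end Discrete

/-- A channel with memory and feedback: the conditional law of the output `q'_t`
given the inputs `q_{[0,t]}` and the past outputs `q'_{[0,t-1]}`. -/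
abbrev Channel (M M' : Type*) : Type _ :=
  ∀ t : ℕ, (Fin (t + 1) → M) → (Fin t → M') → PMF M'

/-- A causal coding policy: `q_t = γᵉ_t (x_{[0,t]}, q'_{[0,t-1]})`. -/
abbrev CodingPolicy (N : ℕ) (M M' : Type*) : Type _ :=
  ∀ t : ℕ, (Fin (t + 1) → Vec N) → (Fin t → M') → M

/-- A causal control policy: `u_t = γ_t (q'_{[0,t]})`. -/
abbrev ControlPolicy (s : ℕ) (M' : Type*) : Type _ :=
  ∀ t : ℕ, (Fin (t + 1) → M') → Vec s

/-- The processes `x, w, q, q'` on the probability space `(Ω, P)` form the closed loop of the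
system `x_{t+1} = f (x_t, w_t) + B u_t` with noise law `ν`, channel `ch` and
policies `γe`, `γ`. -/
structure IsClosedLoop {N d s : ℕ} {M M' : Type*} [MeasurableSpace M] [MeasurableSpace M']
    {Ω : Type*} [MeasurableSpace Ω] (P : Measure Ω)
    (f : Vec N → Vec d → Vec N) (B : Matrix (Fin N) (Fin s) ℝ) (ν : Measure (Vec d))
    (ch : Channel M M') (γe : CodingPolicy N M M') (γ : ControlPolicy s M')
    (x : ℕ → Ω → Vec N) (w : ℕ → Ω → Vec d) (q : ℕ → Ω → M) (q' : ℕ → Ω → M') : Prop where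
  measurable_init : Measurable (x 0)
  measurable_noise : ∀ t, Measurable (w t)
  measurable_output : ∀ t, Measurable (q' t)
  /-- The noise is i.i.d. with law `ν` and independent of the initial state. -/
  noise_law : ∀ t, P.map (w t) = ν
  noise_indep : iIndepFun w P
  init_indep : IndepFun (x 0) (fun ω t => w t ω) P
  /-- The plant. -/
  state_eq : ∀ t ω, x (t + 1) ω =
    f (x t ω) (w t ω) + Matrix.toEuclideanLin B (γ t (history q' (t + 1) ω))
  /-- The encoder. -/
  input_eq : ∀ t ω, q t ω = γe t (history x (t + 1) ω) (history q' t ω)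
  /-- The channel: conditionally on the initial state, the whole noise sequence, the inputs up to
  time `t` and the outputs before time `t`, the law of `q'_t` is the one given by the channel.
  In particular `q'_t ↔ (q_{[0,t]}, q'_{[0,t-1]}) ↔ (x₀, (w_r)_{r ≥ 0})` is a Markov chain. -/
  output_law : ∀ t b,
    P[(q' t ⁻¹' {b}).indicator (fun _ => (1 : ℝ)) |
      MeasurableSpace.comap
        (fun ω => ((x 0 ω, fun r => w r ω), (history q (t + 1) ω, history q' t ω)))
        inferInstance]
      =ᵐ[P] fun ω => (ch t (history q (t + 1) ω) (history q' t ω) b).toReal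

/-- `∫∫ log₂ |det J(f(x, w))| π(dx) ν(dw)`, where `J(f(x, w))` is the Jacobian of `f(·, w)`
at `x`. -/
def expLogJacobian {N d : ℕ} (f : Vec N → Vec d → Vec N)
    (π : Measure (Vec N)) (ν : Measure (Vec d)) : EReal :=
  extIntegral (π.prod ν) fun z => log2Abs (fderiv ℝ (fun y => f y z.2) z.1).det

end

end BodeFormula

/-!
Fix the noise and the outputs. Then the controls are constants, `x₀ ↦ x_T` is injective, and a
change of variables expresses the joint law of `x_T`, the outputs and the noise through the density
`p₀(x₀) ∏ κ_t(q'_t) / ∏ |J(f(x_t, w_t))|`. The ratio `R_T` of the product of the marginal laws to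
this joint law has expectation at most `1`, so `E log₂ R_T ≤ 0` because `log r ≤ r - 1`. Written
out, with `E log₂ (∏ κ_t(q'_t) / P(q'_{[0,T-1]}))` being the directed information, this says
`∑_{t < T} E log₂ |J(f(x_t, w_t))| + h(x₀) ≤ h(x_T) + I(q_{[0,T-1]} → q'_{[0,T-1]})`,
and dividing by `T` gives the theorem.
-/

namespace BodeFormula

section ExtIntegral

variable {α : Type*} [MeasurableSpace α] {μ : Measure α} {g h : α → EReal}

lemma extIntegral_eq_bot_iff : extIntegral μ g = ⊥ ↔ ∫⁻ a, (-(g a)).toENNReal ∂μ = ⊤ := by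
  rw [extIntegral, sub_eq_add_neg, EReal.add_eq_bot_iff, EReal.neg_eq_bot_iff,
    EReal.coe_ennreal_eq_top_iff]
  exact or_iff_right (EReal.coe_ennreal_ne_bot _)

lemma extIntegral_mono_ae (hgh : g ≤ᵐ[μ] h) : extIntegral μ g ≤ extIntegral μ h := by
  refine EReal.sub_le_sub (EReal.coe_ennreal_le_coe_ennreal_iff.2 (lintegral_mono_ae ?_))
    (EReal.coe_ennreal_le_coe_ennreal_iff.2 (lintegral_mono_ae ?_))
  · filter_upwards [hgh] with a ha using EReal.toENNReal_le_toENNReal ha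
  · filter_upwards [hgh] with a ha using EReal.toENNReal_le_toENNReal (EReal.neg_le_neg_iff.2 ha)

lemma ae_ne_bot_of_extIntegral_ne_bot (hg : AEMeasurable g μ) (h_int : extIntegral μ g ≠ ⊥) :
    ∀ᵐ a ∂μ, g a ≠ ⊥ := by
  filter_upwards [ae_lt_top' (measurable_ereal_toENNReal.comp_aemeasurable hg.neg)
    (mt extIntegral_eq_bot_iff.2 h_int)] with a ha hbot
  simp [hbot] at ha

lemma extIntegral_map {β : Type*} [MeasurableSpace β] {X : α → β} (hX : AEMeasurable X μ)
    {g : β → EReal} (hg : Measurable g) :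
    extIntegral (μ.map X) g = extIntegral μ fun a => g (X a) := by
  have hg_neg : Measurable fun b => (-(g b)).toENNReal := hg.neg.ereal_toENNReal
  rw [extIntegral, extIntegral, lintegral_map' hg.ereal_toENNReal.aemeasurable hX,
    lintegral_map' hg_neg.aemeasurable hX]

lemma extIntegral_coe {g : α → ℝ} (hg : Integrable g μ) :
    extIntegral μ (fun a => (g a : EReal)) = (∫ a, g a ∂μ : ℝ) := by
  have hpos : ∫⁻ a, ENNReal.ofReal (g a) ∂μ ≠ ⊤ := hg.lintegral_lt_top.ne
  have hneg : ∫⁻ a, ENNReal.ofReal (-g a) ∂μ ≠ ⊤ := hg.neg.lintegral_lt_top.ne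
  rw [integral_eq_lintegral_pos_part_sub_lintegral_neg_part hg, EReal.coe_sub,
    EReal.coe_ennreal_toReal hpos, EReal.coe_ennreal_toReal hneg]
  rfl

lemma toENNReal_add_toENNReal_add_toENNReal_neg_add_le {a b : EReal} (ha : a ≠ ⊥) (hb : b ≠ ⊥) :
    a.toENNReal + b.toENNReal + (-(a + b)).toENNReal ≤
      (a + b).toENNReal + ((-a).toENNReal + (-b).toENNReal) := by
  induction a with
  | bot => exact absurd rfl ha
  | top => simp [EReal.top_add_of_ne_bot hb]
  | coe a =>
    induction b with
    | bot => exact absurd rfl hb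
    | top => simp
    | coe b =>
      rw [← EReal.coe_add, ← EReal.coe_neg, ← EReal.coe_neg, ← EReal.coe_neg]
      simp only [EReal.real_coe_toENNReal, ENNReal.ofReal]
      norm_cast
      rw [← NNReal.coe_le_coe]
      simp only [NNReal.coe_add, Real.coe_toNNReal']
      grind

lemma coe_sub_coe_add_coe_sub_coe_le {a b c a' b' c' : ENNReal} (ha' : a' ≠ ⊤) (hb' : b' ≠ ⊤)
    (hc' : c' ≠ ⊤) (hle : a + b + c' ≤ c + (a' + b')) :
    (a - a' + (b - b') : EReal) ≤ c - c' := by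
  lift a' to NNReal using ha'
  lift b' to NNReal using hb'
  lift c' to NNReal using hc'
  induction c with
  | top => simp
  | coe c =>
    have h_fin : a + b ≠ ⊤ := ne_top_of_le_ne_top (by finiteness) (le_self_add.trans hle)
    lift a to NNReal using (ENNReal.add_ne_top.1 h_fin).1
    lift b to NNReal using (ENNReal.add_ne_top.1 h_fin).2
    norm_cast at hle ⊢
    rw [← NNReal.coe_le_coe] at hle
    push_cast at hle
    simp only [EReal.coe_nnreal_eq_coe_real]
    norm_cast
    linarith

lemma extIntegral_add_le (hg : AEMeasurable g μ) (hh : AEMeasurable h μ) :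
    extIntegral μ g + extIntegral μ h ≤ extIntegral μ fun a => g a + h a := by
  rcases eq_or_ne (extIntegral μ g) ⊥ with hg_bot | hg_bot
  · simp [hg_bot]
  rcases eq_or_ne (extIntegral μ h) ⊥ with hh_bot | hh_bot
  · simp [hh_bot]
  have hg_fin := mt extIntegral_eq_bot_iff.2 hg_bot
  have hh_fin := mt extIntegral_eq_bot_iff.2 hh_bot
  have hg_pos : AEMeasurable (fun a => (g a).toENNReal) μ := hg.ereal_toENNReal
  have hg_neg : AEMeasurable (fun a => (-(g a)).toENNReal) μ := hg.neg.ereal_toENNReal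
  have hh_pos : AEMeasurable (fun a => (h a).toENNReal) μ := hh.ereal_toENNReal
  have hgh_pos : AEMeasurable (fun a => (g a + h a).toENNReal) μ := (hg.add hh).ereal_toENNReal
  have h_ne_bot := (ae_ne_bot_of_extIntegral_ne_bot hg hg_bot).and
    (ae_ne_bot_of_extIntegral_ne_bot hh hh_bot)
  refine coe_sub_coe_add_coe_sub_coe_le hg_fin hh_fin
    (ne_top_of_le_ne_top (ENNReal.add_ne_top.2 ⟨hg_fin, hh_fin⟩) ?_) ?_
  · rw [← lintegral_add_left' hg_neg]
    refine lintegral_mono_ae (h_ne_bot.mono fun a ha => ?_)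
    rw [EReal.neg_add (Or.inl ha.1) (Or.inr ha.2), sub_eq_add_neg]
    exact EReal.toENNReal_add_le
  · rw [← lintegral_add_left' hg_pos, ← lintegral_add_left' hg_neg,
      ← lintegral_add_left' (hg_pos.fun_add hh_pos), ← lintegral_add_left' hgh_pos]
    exact lintegral_mono_ae (h_ne_bot.mono fun a ha =>
      toENNReal_add_toENNReal_add_toENNReal_neg_add_le ha.1 ha.2)

lemma sum_extIntegral_le {ι : Type*} (s : Finset ι) {g : ι → α → EReal}
    (hg : ∀ i ∈ s, AEMeasurable (g i) μ) :
    ∑ i ∈ s, extIntegral μ (g i) ≤ extIntegral μ fun a => ∑ i ∈ s, g i a := by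
  classical
  induction s using Finset.induction_on with
  | empty => simp [extIntegral]
  | insert i s hi ih =>
    simp only [Finset.sum_insert hi]
    have hs : ∀ j ∈ s, AEMeasurable (g j) μ := fun j hj => hg j (Finset.mem_insert_of_mem hj)
    exact (add_le_add_right (ih hs) _).trans
      (extIntegral_add_le (hg i (Finset.mem_insert_self i s)) (Finset.aemeasurable_fun_sum s hs))

lemma extIntegral_add_coe_le (hg : AEMeasurable g μ) {u : α → ℝ} (hu : Integrable u μ) :
    extIntegral μ (fun a => g a + (u a : EReal)) ≤ extIntegral μ g + (∫ a, u a ∂μ : ℝ) := by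
  have hu_coe : AEMeasurable (fun a => (u a : EReal)) μ := hu.1.aemeasurable.coe_real_ereal
  have hu_neg : Integrable (fun a => -u a) μ := hu.neg
  have h := extIntegral_add_le (hg.fun_add hu_coe) hu_neg.1.aemeasurable.coe_real_ereal
  rw [extIntegral_coe hu_neg, integral_neg, EReal.coe_neg, ← sub_eq_add_neg] at h
  have h_cancel : ∀ a, g a + (u a : EReal) + ((-u a : ℝ) : EReal) = g a := fun a => by
    rw [add_assoc, ← EReal.coe_add, add_neg_cancel, EReal.coe_zero, add_zero]
  simp only [h_cancel] at h
  exact (EReal.sub_le_iff_le_add (Or.inl (EReal.coe_ne_bot _)) (Or.inl (EReal.coe_ne_top _))).1 h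

end ExtIntegral

section Limsup

lemma limsup_div_natCast_le_of_add_le_add {a b H : ℕ → EReal} {c : ℝ}
    (hle : ∀ T, a T + (c : EReal) ≤ H T + b T)
    (hH : limsup (fun T : ℕ => H T / (T : EReal)) atTop ≤ 0) :
    limsup (fun T : ℕ => a T / (T : EReal)) atTop ≤
      limsup (fun T : ℕ => b T / (T : EReal)) atTop := by
  have h_nonneg : ∀ T : ℕ, (0 : EReal) ≤ (T : EReal) := fun T => mod_cast Nat.zero_le T
  have hc : limsup (fun T : ℕ => ((-c : ℝ) : EReal) / (T : EReal)) atTop = 0 := by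
    have h_tendsto := (continuous_coe_real_ereal.tendsto 0).comp
      (tendsto_const_div_atTop_nhds_zero_nat (-c))
    exact h_tendsto.limsup_eq
  have ha : ∀ T : ℕ, a T / (T : EReal) =
      (a T + (c : EReal)) / (T : EReal) + ((-c : ℝ) : EReal) / (T : EReal) := fun T => by
    rw [← EReal.add_div_of_nonneg_right (h_nonneg T), add_assoc, ← EReal.coe_add, add_neg_cancel,
      EReal.coe_zero, add_zero]
  rcases eq_or_ne (limsup (fun T : ℕ => b T / (T : EReal)) atTop) ⊤ with hb | hb
  · simp [hb]
  calc limsup (fun T : ℕ => a T / (T : EReal)) atTop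
      ≤ limsup (fun T : ℕ => (a T + (c : EReal)) / (T : EReal)) atTop +
          limsup (fun T : ℕ => ((-c : ℝ) : EReal) / (T : EReal)) atTop := by
        simp only [ha]
        exact EReal.limsup_add_le (Or.inr (hc ▸ EReal.zero_ne_top))
          (Or.inr (hc ▸ EReal.zero_ne_bot))
    _ ≤ limsup (fun T : ℕ => H T / (T : EReal) + b T / (T : EReal)) atTop := by
        rw [hc, add_zero]
        refine limsup_le_limsup (Eventually.of_forall fun T => ?_)
        simp only [← EReal.add_div_of_nonneg_right (h_nonneg T)]
        exact EReal.div_le_div_right_of_nonneg (h_nonneg T) (hle T)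
    _ ≤ limsup (fun T : ℕ => H T / (T : EReal)) atTop +
          limsup (fun T : ℕ => b T / (T : EReal)) atTop :=
        EReal.limsup_add_le (Or.inr hb) (Or.inl (ne_top_of_le_ne_top EReal.zero_ne_top hH))
    _ ≤ limsup (fun T : ℕ => b T / (T : EReal)) atTop :=
        (add_le_add_left hH _).trans_eq (zero_add _)

end Limsup

section Entropy

lemma log2Abs_of_ne_zero {y : ℝ} (hy : y ≠ 0) : log2Abs y = (Real.logb 2 |y| : ℝ) := if_neg hy

lemma sum_log2Abs_of_ne_zero {ι : Type*} {I : Finset ι} {y : ι → ℝ} (hy : ∀ i ∈ I, y i ≠ 0) :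
    ∑ i ∈ I, log2Abs (y i) = (∑ i ∈ I, Real.logb 2 |y i| : ℝ) :=
  (Finset.sum_congr rfl fun i hi => log2Abs_of_ne_zero (hy i hi)).trans
    (map_sum (⟨⟨Real.toEReal, EReal.coe_zero⟩, EReal.coe_add⟩ : ℝ →+ EReal) _ I).symm

lemma log2Abs_eq_bot_iff {y : ℝ} : log2Abs y = ⊥ ↔ y = 0 := by
  simp [log2Abs]

lemma measurable_log2Abs : Measurable log2Abs :=
  Measurable.ite (measurableSet_singleton 0) measurable_const
    ((Real.measurable_log.comp measurable_norm).div_const _).coe_real_ereal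

lemma extIntegral_rnDeriv_mul {α : Type*} [MeasurableSpace α] {μ ρ : Measure α} [SigmaFinite μ]
    [SigmaFinite ρ] (hac : μ ≪ ρ) {φ : α → ℝ} (hφ : Measurable φ) :
    extIntegral ρ (fun a => (((μ.rnDeriv ρ a).toReal * φ a : ℝ) : EReal)) =
      extIntegral μ fun a => (φ a : EReal) := by
  have h_lintegral : ∀ ψ : α → ℝ, Measurable ψ →
      ∫⁻ a, ENNReal.ofReal ((μ.rnDeriv ρ a).toReal * ψ a) ∂ρ =
        ∫⁻ a, ENNReal.ofReal (ψ a) ∂μ := fun ψ hψ => by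
    rw [← lintegral_rnDeriv_mul hac hψ.ennreal_ofReal.aemeasurable]
    refine lintegral_congr_ae ?_
    filter_upwards [Measure.rnDeriv_lt_top μ ρ] with a ha
    rw [ENNReal.ofReal_mul ENNReal.toReal_nonneg, ENNReal.ofReal_toReal ha.ne]
  have h_neg := h_lintegral (fun a => -φ a) hφ.neg
  simp only [mul_neg] at h_neg
  simp only [extIntegral, ← EReal.coe_neg, EReal.real_coe_toENNReal, h_lintegral φ hφ, h_neg]

variable {n : ℕ} {μ : Measure (Vec n)}

lemma diffEntropy_of_absolutelyContinuous [SigmaFinite μ] (hac : μ ≪ volume) :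
    diffEntropy μ =
      extIntegral μ fun y => ((-Real.logb 2 (μ.rnDeriv volume y).toReal : ℝ) : EReal) := by
  have hφ : Measurable fun y => -Real.logb 2 (μ.rnDeriv volume y).toReal :=
    ((Measure.measurable_rnDeriv _ _).ennreal_toReal.log.div_const _).neg
  rw [diffEntropy, if_pos hac, ← extIntegral_rnDeriv_mul hac hφ]
  simp only [Real.negMulLog, Real.logb, mul_neg, neg_mul, neg_div, mul_div_assoc]

lemma absolutelyContinuous_of_diffEntropy_ne_bot (h : diffEntropy μ ≠ ⊥) : μ ≪ volume := by
  by_contra hac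
  exact h (if_neg hac)

end Entropy

section FiniteValued

variable {Ω : Type*} [MeasurableSpace Ω] {P : Measure Ω}

/-- The probability mass of the value that the random variable `X` takes at `ω`. Entropies of
finitely valued random variables are integrals of its logarithm. -/
noncomputable def massAt {S : Type*} (P : Measure Ω) (X : Ω → S) (ω : Ω) : ENNReal :=
  P (X ⁻¹' {X ω})

lemma massAt_comp_of_injective {S S' : Type*} {e : S → S'} (he : Function.Injective e)
    (X : Ω → S) : massAt P (fun ω => e (X ω)) = massAt P X := by
  ext ω
  simp only [massAt, Set.preimage, Set.mem_singleton_iff, he.eq_iff]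

lemma massAt_of_subsingleton {S : Type*} [Subsingleton S] (X : Ω → S) (ω : Ω) :
    massAt P X ω = P Set.univ := by
  simp only [massAt, Set.preimage, Set.mem_singleton_iff, eq_iff_true_of_subsingleton,
    Set.ofPred_true]

lemma massAt_ne_top [IsFiniteMeasure P] {S : Type*} (X : Ω → S) (ω : Ω) : massAt P X ω ≠ ⊤ :=
  measure_ne_top P _

lemma ae_massAt_ne_zero {S : Type*} [Countable S] (X : Ω → S) : ∀ᵐ ω ∂P, massAt P X ω ≠ 0 := by
  have h : ∀ s, ∀ᵐ ω ∂P, X ω = s → P (X ⁻¹' {s}) ≠ 0 := fun s => by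
    by_cases hs : P (X ⁻¹' {s}) = 0
    · filter_upwards [measure_eq_zero_iff_ae_notMem.1 hs] with ω hω h using absurd h hω
    · exact ae_of_all _ fun _ _ => hs
  filter_upwards [ae_all_iff.2 h] with ω hω using hω _ rfl

lemma integrable_comp_of_finite [IsFiniteMeasure P] {S : Type*} [Finite S] [MeasurableSpace S]
    [MeasurableSingletonClass S] {X : Ω → S} (hX : Measurable X) (φ : S → ℝ) :
    Integrable (fun ω => φ (X ω)) P :=
  (Integrable.of_finite (μ := P.map X) (f := φ)).comp_measurable hX

lemma measurable_massAt {S : Type*} [Countable S] [MeasurableSpace S] [MeasurableSingletonClass S]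
    {X : Ω → S} (hX : Measurable X) : Measurable (massAt P X) :=
  Measurable.comp (g := fun s => P (X ⁻¹' {s})) .of_discrete hX

lemma integrable_logb_massAt [IsFiniteMeasure P] {S : Type*} [Finite S] [MeasurableSpace S]
    [MeasurableSingletonClass S] {X : Ω → S} (hX : Measurable X) (b : ℝ) :
    Integrable (fun ω => Real.logb b (massAt P X ω).toReal) P :=
  integrable_comp_of_finite hX fun s => Real.logb b (P (X ⁻¹' {s})).toReal

variable {S : Type*} [Fintype S] [MeasurableSpace S] [MeasurableSingletonClass S]
  {S' : Type*} [Fintype S'] [MeasurableSpace S'] [MeasurableSingletonClass S']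
  {U : Type*} [Fintype U] [MeasurableSpace U] [MeasurableSingletonClass U]

lemma integral_comp_eq_sum [IsFiniteMeasure P] {X : Ω → S} (hX : Measurable X) (φ : S → ℝ) :
    ∫ ω, φ (X ω) ∂P = ∑ s, P.real (X ⁻¹' {s}) * φ s := by
  rw [← integral_map hX.aemeasurable Measurable.of_discrete.aestronglyMeasurable,
    integral_fintype Integrable.of_finite]
  simp only [map_measureReal_apply hX (measurableSet_singleton _), smul_eq_mul]

lemma lintegral_eq_sum_setLIntegral_preimage {X : Ω → S} (hX : Measurable X) (g : Ω → ENNReal) :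
    ∫⁻ ω, g ω ∂P = ∑ s, ∫⁻ ω in X ⁻¹' {s}, g ω ∂P := by
  rw [← lintegral_biUnion_finset (fun s _ s' _ hss' => Disjoint.preimage X (by simpa using hss'))
    fun s _ => hX (measurableSet_singleton s)]
  simp [← Set.preimage_iUnion, Set.iUnion_of_singleton]

lemma real_mul_negMulLog_cond [IsFiniteMeasure P] {A E : Set Ω} (hA : MeasurableSet A) :
    P.real A * (Real.negMulLog ((P[|A]).real E) / Real.log 2) =
      P.real (A ∩ E) * (Real.logb 2 (P.real A) - Real.logb 2 (P.real (A ∩ E))) := by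
  rw [measureReal_def P[|A], cond_apply hA, ENNReal.toReal_mul, ENNReal.toReal_inv,
    ← measureReal_def, ← measureReal_def]
  rcases eq_or_ne (P.real (A ∩ E)) 0 with hAE | hAE
  · simp [hAE]
  have hA0 : P.real A ≠ 0 := fun h =>
    hAE (le_antisymm (h ▸ measureReal_mono Set.inter_subset_left) measureReal_nonneg)
  rw [Real.negMulLog, Real.log_mul (inv_ne_zero hA0) hAE, Real.log_inv, Real.logb, Real.logb]
  field_simp
  ring

lemma condEntropy_eq_integral [IsFiniteMeasure P] {X : Ω → S} {Z : Ω → U} (hX : Measurable X)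
    (hZ : Measurable Z) :
    condEntropy P X Z = ∫ ω, (Real.logb 2 (massAt P Z ω).toReal -
      Real.logb 2 (massAt P (fun ω => (X ω, Z ω)) ω).toReal) ∂P := by
  have h_sum := integral_comp_eq_sum (P := P) (hX.prodMk hZ) fun a =>
    Real.logb 2 (P.real (Z ⁻¹' {a.2})) - Real.logb 2 (P.real ((fun ω => (X ω, Z ω)) ⁻¹' {a}))
  refine Eq.trans ?_ h_sum.symm
  have h_preimage : ∀ a u, (fun ω => (X ω, Z ω)) ⁻¹' {(a, u)} = Z ⁻¹' {u} ∩ X ⁻¹' {a} :=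
    fun a u => by ext ω; simp [and_comm]
  simp only [condEntropy, entropy, Finset.mul_sum, Fintype.sum_prod_type_right, h_preimage,
    real_mul_negMulLog_cond (hZ (measurableSet_singleton _))]

lemma condMutualInfo_eq_integral [IsFiniteMeasure P] {X : Ω → S} {Y : Ω → S'} {Z : Ω → U}
    (hX : Measurable X) (hY : Measurable Y) (hZ : Measurable Z) (c : S → U → S' → ENNReal)
    (hc : ∀ a u b, P (X ⁻¹' {a} ∩ Z ⁻¹' {u} ∩ Y ⁻¹' {b}) =
      c a u b * P (X ⁻¹' {a} ∩ Z ⁻¹' {u})) :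
    condMutualInfo P X Y Z = ∫ ω, (Real.logb 2 (c (X ω) (Z ω) (Y ω)).toReal +
      Real.logb 2 (massAt P Z ω).toReal -
      Real.logb 2 (massAt P (fun ω => (Y ω, Z ω)) ω).toReal) ∂P := by
  have hYZ := hY.prodMk hZ
  rw [condMutualInfo, condEntropy_eq_integral hX hZ, condEntropy_eq_integral hX hYZ,
    ← integral_sub ((integrable_logb_massAt hZ 2).sub' (integrable_logb_massAt (hX.prodMk hZ) 2))
      ((integrable_logb_massAt hYZ 2).sub' (integrable_logb_massAt (hX.prodMk hYZ) 2))]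
  refine integral_congr_ae ?_
  filter_upwards [ae_massAt_ne_zero (P := P) fun ω => (X ω, (Y ω, Z ω))] with ω hω
  have h_mass : massAt P (fun ω => (X ω, (Y ω, Z ω))) ω =
      c (X ω) (Z ω) (Y ω) * massAt P (fun ω => (X ω, Z ω)) ω := by
    have h_XYZ : (fun ω => (X ω, (Y ω, Z ω))) ⁻¹' {(X ω, (Y ω, Z ω))} =
        X ⁻¹' {X ω} ∩ Z ⁻¹' {Z ω} ∩ Y ⁻¹' {Y ω} := by
      ext ω'
      simp only [Set.mem_preimage, Set.mem_inter_iff, Set.mem_singleton_iff, Prod.mk.injEq]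
      tauto
    have h_XZ : (fun ω => (X ω, Z ω)) ⁻¹' {(X ω, Z ω)} = X ⁻¹' {X ω} ∩ Z ⁻¹' {Z ω} := by
      ext ω'; simp
    rw [massAt, massAt, h_XYZ, h_XZ, hc]
  have h_real : (massAt P (fun ω => (X ω, (Y ω, Z ω))) ω).toReal ≠ 0 :=
    (ENNReal.toReal_pos hω (massAt_ne_top _ ω)).ne'
  rw [h_mass, ENNReal.toReal_mul] at h_real ⊢
  rw [Real.logb_mul (left_ne_zero_of_mul h_real) (right_ne_zero_of_mul h_real)]
  ring

end FiniteValued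

section MeanAtMostOne

variable {Ω : Type*} [MeasurableSpace Ω] {P : Measure Ω} [IsProbabilityMeasure P] {R : Ω → ENNReal}

lemma integrable_toReal_sub_one_div (hR : AEMeasurable R P) (hR_le : ∫⁻ ω, R ω ∂P ≤ 1) (c : ℝ) :
    Integrable (fun ω => ((R ω).toReal - 1) / c) P :=
  ((integrable_toReal_of_lintegral_ne_top hR
    (hR_le.trans_lt ENNReal.one_lt_top).ne).sub' (integrable_const 1)).div_const c

lemma integral_toReal_sub_one_div_nonpos (hR : AEMeasurable R P) (hR_le : ∫⁻ ω, R ω ∂P ≤ 1) {c : ℝ}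
    (hc : 0 ≤ c) : ∫ ω, ((R ω).toReal - 1) / c ∂P ≤ 0 := by
  have hR_ne_top := (hR_le.trans_lt ENNReal.one_lt_top).ne
  rw [integral_div, integral_sub (integrable_toReal_of_lintegral_ne_top hR hR_ne_top)
    (integrable_const 1), integral_toReal hR (ae_lt_top' hR hR_ne_top), integral_const,
    probReal_univ, one_smul]
  exact div_nonpos_of_nonpos_of_nonneg
    (sub_nonpos.2 (ENNReal.toReal_mono ENNReal.one_ne_top hR_le)) hc

end MeanAtMostOne

section History

variable {Ω S : Type*} {a : ℕ → Ω → S}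

lemma history_succ (t : ℕ) (ω : Ω) :
    history a (t + 1) ω = Fin.snoc (α := fun _ => S) (history a t ω) (a t ω) :=
  (Fin.snoc_init_self (history a (t + 1) ω)).symm

lemma measurable_history {m : MeasurableSpace Ω} [MeasurableSpace S] {t : ℕ}
    (ha : ∀ i < t, Measurable[m] (a i)) : Measurable[m] (history a t) :=
  measurable_pi_lambda _ fun i => ha i i.isLt

variable [MeasurableSpace Ω] {P : Measure Ω}

lemma massAt_history_zero [IsProbabilityMeasure P] (ω : Ω) : massAt P (history a 0) ω = 1 := by
  rw [massAt_of_subsingleton, measure_univ]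

lemma massAt_history_succ (t : ℕ) :
    massAt P (history a (t + 1)) = massAt P fun ω => (a t ω, history a t ω) := by
  have h_inj : Function.Injective fun p : S × (Fin t → S) =>
      Fin.snoc (α := fun _ => S) p.2 p.1 := fun p p' h =>
    Prod.ext_iff.2 (Fin.snoc_inj.1 h).symm
  rw [← massAt_comp_of_injective h_inj]
  exact congrArg (massAt P) (funext (history_succ t))

end History

section DirectedInfo

/-- The conditional probability, under the channel, of the output `q'_t` observed at `ω`. -/
noncomputable def channelProb {Ω M M' : Type*} (ch : Channel M M') (q : ℕ → Ω → M)
    (q' : ℕ → Ω → M') (t : ℕ) (ω : Ω) : ENNReal :=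
  ch t (history q (t + 1) ω) (history q' t ω) (q' t ω)

/-- The directed information density `log₂ (∏_{t < T} κ_t(q'_t) / P(q'_{[0,T-1]}))`: its expectation
is the directed information. -/
noncomputable def directedInfoDensity {Ω M M' : Type*} [MeasurableSpace Ω] (P : Measure Ω)
    (ch : Channel M M') (q : ℕ → Ω → M) (q' : ℕ → Ω → M') (T : ℕ) (ω : Ω) : ℝ :=
  ∑ t ∈ Finset.range T, Real.logb 2 (channelProb ch q q' t ω).toReal -
    Real.logb 2 (massAt P (history q' T) ω).toReal

variable {Ω : Type*} [MeasurableSpace Ω] {P : Measure Ω} [IsProbabilityMeasure P]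
  {M M' : Type*} [MeasurableSpace M] [MeasurableSingletonClass M]
  [MeasurableSpace M'] [MeasurableSingletonClass M']
  {q : ℕ → Ω → M} {q' : ℕ → Ω → M'} {ch : Channel M M'}

lemma integrable_logb_channelProb [Finite M] [Finite M']
    (hq : ∀ t, Measurable (q t)) (hq' : ∀ t, Measurable (q' t)) (t : ℕ) :
    Integrable (fun ω => Real.logb 2 (channelProb ch q q' t ω).toReal) P :=
  integrable_comp_of_finite ((measurable_history fun i _ => hq i).prodMk
      ((measurable_history fun i _ => hq' i).prodMk (hq' t)))
    fun z => Real.logb 2 (ch t z.1 z.2.1 z.2.2).toReal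

lemma integrable_directedInfoDensity [Finite M] [Finite M']
    (hq : ∀ t, Measurable (q t)) (hq' : ∀ t, Measurable (q' t)) (T : ℕ) :
    Integrable (directedInfoDensity P ch q q' T) P :=
  (integrable_finsetSum _ fun t _ => integrable_logb_channelProb hq hq' t).sub'
    (integrable_logb_massAt (measurable_history fun i _ => hq' i) 2)

lemma directedInfo_eq_integral [Fintype M] [Fintype M']
    (hq : ∀ t, Measurable (q t)) (hq' : ∀ t, Measurable (q' t))
    (hch : ∀ t a u b, P (history q (t + 1) ⁻¹' {a} ∩ history q' t ⁻¹' {u} ∩ q' t ⁻¹' {b}) =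
      ch t a u b * P (history q (t + 1) ⁻¹' {a} ∩ history q' t ⁻¹' {u})) (T : ℕ) :
    directedInfo P q q' T =
      ∫ ω, directedInfoDensity P ch q q' T ω ∂P := by
  have h_mass := fun t =>
    integrable_logb_massAt (P := P) (measurable_history (t := t) fun i _ => hq' i) 2
  have h_term : ∀ t, condMutualInfo P (history q (t + 1)) (q' t) (history q' t) =
      ∫ ω, Real.logb 2 (channelProb ch q q' t ω).toReal ∂P +
        ∫ ω, Real.logb 2 (massAt P (history q' t) ω).toReal ∂P -
        ∫ ω, Real.logb 2 (massAt P (history q' (t + 1)) ω).toReal ∂P := fun t => by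
    have h_ch := integrable_logb_channelProb (P := P) (ch := ch) hq hq' t
    rw [condMutualInfo_eq_integral (measurable_history fun i _ => hq i) (hq' t)
      (measurable_history fun i _ => hq' i) (fun a u b => ch t a u b) (hch t),
      ← massAt_history_succ]
    exact (integral_sub (h_ch.add (h_mass t)) (h_mass (t + 1))).trans
      (congrArg (· - _) (integral_add h_ch (h_mass t)))
  simp only [directedInfoDensity]
  rw [integral_sub (integrable_finsetSum _ fun t _ => integrable_logb_channelProb hq hq' t)
      (h_mass T),
    integral_finsetSum _ fun t _ => integrable_logb_channelProb hq hq' t, directedInfo]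
  induction T with
  | zero => simp [massAt_history_zero]
  | succ T ih =>
    rw [Finset.sum_range_succ, ih, h_term, Finset.sum_range_succ]
    ring

end DirectedInfo

section Density

variable {Ω E : Type*} {m : MeasurableSpace Ω} [MeasurableSpace Ω] {P : Measure Ω} [MeasureSpace E]

/-- The Lebesgue density of the law of the random variable `X`, evaluated at `X` itself: the
analogue of `massAt` for differential entropy. -/
noncomputable def densityAt (P : Measure Ω) (X : Ω → E) (ω : Ω) : ENNReal :=
  (P.map X).rnDeriv volume (X ω)

lemma measurable_densityAt {X : Ω → E} (hX : Measurable[m] X) :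
    Measurable[m] (densityAt P X) :=
  (Measure.measurable_rnDeriv _ _).comp hX

lemma measurable_neg_logb_densityAt {X : Ω → E} (hX : Measurable X) :
    Measurable fun ω => ((-Real.logb 2 (densityAt P X ω).toReal : ℝ) : EReal) :=
  ((measurable_densityAt hX).ennreal_toReal.log.div_const _).neg.coe_real_ereal

variable [IsFiniteMeasure P] [SigmaFinite (volume : Measure E)]

lemma ae_densityAt_ne_zero_and_ne_top {X : Ω → E} (hX : Measurable X) (hac : P.map X ≪ volume) :
    ∀ᵐ ω ∂P, densityAt P X ω ≠ 0 ∧ densityAt P X ω ≠ ⊤ := by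
  have h_zero := ae_of_ae_map hX.aemeasurable (Measure.rnDeriv_pos hac)
  have h_top := ae_of_ae_map hX.aemeasurable (hac.ae_le (Measure.rnDeriv_lt_top (P.map X) volume))
  filter_upwards [h_zero, h_top] with ω hω hω' using ⟨hω.ne', hω'.ne⟩

lemma lintegral_comp_mul_inv_densityAt_le {X : Ω → E} (hX : Measurable X)
    (hac : P.map X ≪ volume) {g : E → ENNReal} (hg : Measurable g) :
    ∫⁻ ω, g (X ω) * (densityAt P X ω)⁻¹ ∂P ≤ ∫⁻ y, g y := by
  have h_meas : Measurable fun y => g y * ((P.map X).rnDeriv volume y)⁻¹ :=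
    hg.mul (Measure.measurable_rnDeriv _ _).inv
  calc ∫⁻ ω, g (X ω) * (densityAt P X ω)⁻¹ ∂P
      = ∫⁻ y, g y * ((P.map X).rnDeriv volume y)⁻¹ ∂(P.map X) := (lintegral_map h_meas hX).symm
    _ = ∫⁻ y, (P.map X).rnDeriv volume y * (g y * ((P.map X).rnDeriv volume y)⁻¹) :=
        (lintegral_rnDeriv_mul hac h_meas.aemeasurable).symm
    _ ≤ ∫⁻ y, g y := lintegral_mono fun y => by
        rw [mul_left_comm]
        exact mul_le_of_le_one_right zero_le (ENNReal.mul_inv_le_one _)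

lemma diffEntropy_map {n : ℕ} {X : Ω → Vec n} (hX : Measurable X) (hac : P.map X ≪ volume) :
    diffEntropy (P.map X) =
      extIntegral P fun ω => ((-Real.logb 2 (densityAt P X ω).toReal : ℝ) : EReal) := by
  have h_meas : Measurable fun y => -Real.logb 2 ((P.map X).rnDeriv volume y).toReal :=
    ((Measure.measurable_rnDeriv _ _).ennreal_toReal.log.div_const _).neg
  rw [diffEntropy_of_absolutelyContinuous hac,
    extIntegral_map hX.aemeasurable h_meas.coe_real_ereal]
  rfl

end Density

section CondExp

variable {Ω : Type*} {m m₀ : MeasurableSpace Ω} {P : Measure Ω}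

lemma lintegral_condLExp_mul (hm : m ≤ m₀) [SigmaFinite (P.trim hm)] {X G : Ω → ENNReal}
    (hX : Measurable X) (hG : Measurable[m] G) :
    ∫⁻ ω, P⁻[X|m] ω * G ω ∂P = ∫⁻ ω, X ω * G ω ∂P := by
  have h_trim : (P.withDensity P⁻[X|m]).trim hm = (P.withDensity X).trim hm :=
    @Measure.ext _ m _ _ fun s hs => by
      rw [trim_measurableSet_eq hm hs, trim_measurableSet_eq hm hs, withDensity_apply _ (hm s hs),
        withDensity_apply _ (hm s hs), setLIntegral_condLExp hm P X hs]
  calc ∫⁻ ω, P⁻[X|m] ω * G ω ∂P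
      = ∫⁻ ω, G ω ∂(P.withDensity P⁻[X|m]) :=
        (lintegral_withDensity_eq_lintegral_mul P (measurable_condLExp' m P X)
          (hG.mono hm le_rfl)).symm
    _ = ∫⁻ ω, G ω ∂(P.withDensity X) := by
        rw [← lintegral_trim hm hG, h_trim, lintegral_trim hm hG]
    _ = ∫⁻ ω, X ω * G ω ∂P :=
        lintegral_withDensity_eq_lintegral_mul P hX (hG.mono hm le_rfl)

lemma setLIntegral_eq_lintegral_condExp_mul [IsFiniteMeasure P] (hm : m ≤ m₀) {E : Set Ω}
    (hE : MeasurableSet E) {G : Ω → ENNReal} (hG : Measurable[m] G) :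
    ∫⁻ ω in E, G ω ∂P =
      ∫⁻ ω, ENNReal.ofReal (P[E.indicator (fun _ => (1 : ℝ)) | m] ω) * G ω ∂P := by
  have h_condLExp := condLExp_ofReal (μ := P) m ((integrable_const (1 : ℝ)).indicator hE)
    (ae_of_all _ (Set.indicator_nonneg fun _ _ => zero_le_one))
  have h_indicator : Measurable fun ω => ENNReal.ofReal (E.indicator (fun _ => (1 : ℝ)) ω) :=
    (measurable_const.indicator hE).ennreal_ofReal
  rw [← lintegral_indicator hE]
  calc ∫⁻ ω, E.indicator G ω ∂P
      = ∫⁻ ω, ENNReal.ofReal (E.indicator (fun _ => (1 : ℝ)) ω) * G ω ∂P := by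
        refine lintegral_congr fun ω => ?_
        by_cases hω : ω ∈ E <;> simp [hω]
    _ = ∫⁻ ω, P⁻[fun ω => ENNReal.ofReal (E.indicator (fun _ => (1 : ℝ)) ω)|m] ω * G ω ∂P :=
        (lintegral_condLExp_mul hm h_indicator hG).symm
    _ = ∫⁻ ω, ENNReal.ofReal (P[E.indicator (fun _ => (1 : ℝ)) | m] ω) * G ω ∂P :=
        lintegral_congr_ae (h_condLExp.mono fun ω hω => congrArg (· * G ω) hω)

end CondExp

section Independence

variable {Ω α β δ : Type*} {m₀ : MeasurableSpace Ω} {P : Measure Ω} [MeasurableSpace α]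
  [MeasurableSpace β] [MeasurableSpace δ]

lemma lintegral_comp_of_indepFun [IsFiniteMeasure P] {X : Ω → α} {Y : Ω → β} (hX : Measurable X)
    (hY : Measurable Y) (h_indep : IndepFun X Y P) {F : α × β → ENNReal} (hF : Measurable F) :
    ∫⁻ ω, F (X ω, Y ω) ∂P = ∫⁻ v, ∫⁻ ω, F (X ω, v) ∂P ∂(P.map Y) := by
  rw [← lintegral_map hF (hX.prodMk hY),
    (indepFun_iff_map_prod_eq_prod_map_map hX.aemeasurable hY.aemeasurable).1 h_indep,
    lintegral_prod_symm' F hF]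
  exact lintegral_congr fun v => lintegral_map (hF.comp measurable_prodMk_right) hX

lemma indepFun_prodMk_left [IsFiniteMeasure P] {X : Ω → α} {Y : Ω → β} {Z : Ω → δ}
    (hX : Measurable X) (hY : Measurable Y) (hZ : Measurable Z)
    (hX_YZ : IndepFun X (fun ω => (Y ω, Z ω)) P) (hYZ : IndepFun Y Z P) :
    IndepFun (fun ω => (X ω, Y ω)) Z P := by
  have hXY : IndepFun X Y P := hX_YZ.comp measurable_id measurable_fst
  rw [indepFun_iff_map_prod_eq_prod_map_map hX.aemeasurable hY.aemeasurable] at hXY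
  rw [indepFun_iff_map_prod_eq_prod_map_map hY.aemeasurable hZ.aemeasurable] at hYZ
  rw [indepFun_iff_map_prod_eq_prod_map_map hX.aemeasurable (hY.prodMk hZ).aemeasurable, hYZ]
    at hX_YZ
  rw [indepFun_iff_map_prod_eq_prod_map_map (hX.prodMk hY).aemeasurable hZ.aemeasurable, hXY]
  refine MeasurableEquiv.prodAssoc.map_measurableEquiv_injective ?_
  rw [Measure.prodAssoc_prod, ← hX_YZ,
    Measure.map_map MeasurableEquiv.prodAssoc.measurable ((hX.prodMk hY).prodMk hZ)]
  rfl

end Independence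

section IndepSigmaAlgebra

variable {Ω α : Type*} {m₁ m₂ m₀ : MeasurableSpace Ω} {X : Ω → α}

/-- The sets `A ∩ {X = s}` with `A` measurable for `m₁`: a π-system generating the σ-algebra
`m₁ ⊔ σ(X)` when `X` takes countably many values. -/
def fiberSets (m₁ : MeasurableSpace Ω) (X : Ω → α) : Set (Set Ω) :=
  {E | ∃ A s, MeasurableSet[m₁] A ∧ A ∩ X ⁻¹' {s} = E}

lemma isPiSystem_fiberSets : IsPiSystem (fiberSets m₁ X) := by
  rintro _ ⟨A, s, hA, rfl⟩ _ ⟨A', s', hA', rfl⟩ ⟨ω, ⟨_, hω⟩, ⟨_, hω'⟩⟩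
  obtain rfl : s = s' := hω.symm.trans hω'
  exact ⟨A ∩ A', s, hA.inter hA', Set.inter_inter_distrib_right A A' _⟩

variable [MeasurableSpace α] [Countable α] [MeasurableSingletonClass α]

lemma sup_comap_eq_generateFrom_fiberSets :
    m₁ ⊔ MeasurableSpace.comap X inferInstance =
      MeasurableSpace.generateFrom (fiberSets m₁ X) := by
  have h_basic : ∀ A s, MeasurableSet[m₁] A →
      MeasurableSet[MeasurableSpace.generateFrom (fiberSets m₁ X)] (A ∩ X ⁻¹' {s}) :=
    fun A s hA => MeasurableSpace.measurableSet_generateFrom ⟨A, s, hA, rfl⟩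
  refine le_antisymm (sup_le (fun A hA => ?_) ?_) (MeasurableSpace.generateFrom_le ?_)
  · have hA_eq : A = ⋃ s, A ∩ X ⁻¹' {s} := by
      rw [← Set.inter_iUnion, ← Set.preimage_iUnion, Set.iUnion_of_singleton, Set.preimage_univ,
        Set.inter_univ]
    rw [hA_eq]
    exact @MeasurableSet.iUnion Ω α (MeasurableSpace.generateFrom _) _ _ fun s => h_basic A s hA
  · refine Measurable.comap_le
      (@measurable_to_countable' α Ω _ _ (MeasurableSpace.generateFrom _) X fun s => ?_)
    simpa only [Set.univ_inter] using h_basic Set.univ s (@MeasurableSet.univ Ω m₁)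
  · rintro _ ⟨A, s, hA, rfl⟩
    exact MeasurableSet.inter (le_sup_left (a := m₁) A hA)
      (le_sup_right (a := m₁) _ ⟨{s}, measurableSet_singleton s, rfl⟩)

lemma indep_sup_comap_of_countable {P : Measure Ω} [IsZeroOrProbabilityMeasure P]
    (hm₁ : m₁ ≤ m₀) (hm₂ : m₂ ≤ m₀) (hX : Measurable[m₀] X)
    (h : ∀ s A B, MeasurableSet[m₁] A → MeasurableSet[m₂] B →
      P (A ∩ X ⁻¹' {s} ∩ B) = P (A ∩ X ⁻¹' {s}) * P B) :
    Indep (m₁ ⊔ MeasurableSpace.comap X inferInstance) m₂ P := by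
  refine IndepSets.indep (sup_le hm₁ hX.comap_le) hm₂ isPiSystem_fiberSets
    (@MeasurableSpace.isPiSystem_measurableSet _ m₂) sup_comap_eq_generateFrom_fiberSets
    (@MeasurableSpace.generateFrom_measurableSet _ m₂).symm ?_
  rw [IndepSets_iff]
  rintro _ B ⟨A, s, hA, rfl⟩ hB
  exact h s A B hA hB

lemma setLIntegral_inter_of_indep {P : Measure Ω} (h_indep : Indep m₁ m₂ P) (hm₁ : m₁ ≤ m₀)
    (hm₂ : m₂ ≤ m₀) {A C : Set Ω} (hA : MeasurableSet[m₁] A) (hC : MeasurableSet[m₂] C)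
    {g : Ω → ENNReal} (hg : Measurable[m₁] g) :
    ∫⁻ ω in A ∩ C, g ω ∂P = (∫⁻ ω in A, g ω ∂P) * P C := by
  have h_indep_C : IndepSets {E | MeasurableSet[m₁] E} {C} P := by
    rw [IndepSets_iff]
    rintro E _ hE rfl
    exact (Indep_iff m₁ m₂ P).1 h_indep E _ hE hC
  have h_mul : ∀ ω, (A ∩ C).indicator g ω = A.indicator g ω * C.indicator (fun _ => 1) ω :=
    fun ω => by by_cases hωA : ω ∈ A <;> by_cases hωC : ω ∈ C <;> simp [hωA, hωC]
  rw [← lintegral_indicator ((hm₁ A hA).inter (hm₂ C hC)), lintegral_congr h_mul,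
    lintegral_mul_indicator_eq_lintegral_mul_lintegral_indicator hm₁ 1 (hm₂ C hC) h_indep_C
      (hg.indicator hA), lintegral_indicator (hm₁ A hA), lintegral_indicator_const (hm₂ C hC),
    one_mul]

end IndepSigmaAlgebra

section Jacobian

variable {E V : Type*} [NormedAddCommGroup E] [NormedSpace ℝ E] {f : E → V → E}

/-- The Jacobian determinant of `f(·, v)` at `y`, written `J(f(y, v))` in the theorem. -/
noncomputable def jacobian (f : E → V → E) (y : E) (v : V) : ℝ := (fderiv ℝ (fun y => f y v) y).det

variable [FiniteDimensional ℝ E] [MeasurableSpace E] [BorelSpace E]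

lemma lintegral_comp_mul_jacobian_le {μ : Measure E} [μ.IsAddHaarMeasure] {v : V}
    (hf_diff : Differentiable ℝ fun y => f y v) (hf_inj : Function.Injective fun y => f y v)
    (g : E → ENNReal) :
    ∫⁻ y, g (f y v) * ENNReal.ofReal |jacobian f y v| ∂μ ≤ ∫⁻ y, g y ∂μ := by
  have h_image := lintegral_image_eq_lintegral_abs_det_fderiv_mul μ MeasurableSet.univ
    (fun y _ => (hf_diff y).hasFDerivAt.hasFDerivWithinAt) hf_inj.injOn g
  rw [Measure.restrict_univ] at h_image
  simp only [mul_comm (g _), jacobian]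
  exact h_image.symm.trans_le (setLIntegral_le_lintegral _ g)

variable [MeasurableSpace V]

lemma measurable_fderiv_apply_with_param (hf : Measurable (Function.uncurry f))
    (hf_diff : ∀ v, Differentiable ℝ fun y => f y v) (e : E) :
    Measurable fun z : E × V => fderiv ℝ (fun y => f y z.2) z.1 e := by
  refine measurable_of_tendsto_metrizable
    (f := fun (n : ℕ) z => (n : ℝ) • (f (z.1 + (n : ℝ)⁻¹ • e) z.2 - f z.1 z.2)) (fun n => ?_)
    (tendsto_pi_nhds.2 fun z => ?_)
  · have h_shift : Measurable fun z : E × V => f (z.1 + (n : ℝ)⁻¹ • e) z.2 :=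
      hf.comp ((measurable_fst.add_const _).prodMk measurable_snd)
    have h_point : Measurable fun z : E × V => f z.1 z.2 := hf
    exact (h_shift.sub h_point).const_smul (n : ℝ)
  · have h_deriv : HasFDerivAt (fun y => f y z.2) (fderiv ℝ (fun y => f y z.2) z.1) z.1 :=
      (hf_diff z.2 z.1).hasFDerivAt
    refine h_deriv.lim e ?_
    simpa only [Real.norm_natCast] using tendsto_natCast_atTop_atTop (R := ℝ)

lemma measurable_jacobian (hf : Measurable (Function.uncurry f))
    (hf_diff : ∀ v, Differentiable ℝ fun y => f y v) :
    Measurable fun z : E × V => jacobian f z.1 z.2 := by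
  let basis := Module.finBasis ℝ E
  have h_entry : ∀ i j, Measurable fun z : E × V =>
      basis.coord i (fderiv ℝ (fun y => f y z.2) z.1 (basis j)) := fun i j =>
    (basis.coord i).continuous_of_finiteDimensional.measurable.comp
      (measurable_fderiv_apply_with_param hf hf_diff (basis j))
  have h_det : ∀ z : E × V, jacobian f z.1 z.2 = (Matrix.of fun i j =>
      basis.coord i (fderiv ℝ (fun y => f y z.2) z.1 (basis j))).det := fun z => by
    rw [jacobian, ContinuousLinearMap.det, ← LinearMap.det_toMatrix basis]
    congr 1 with i j
    exact LinearMap.toMatrix_apply basis basis _ i j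
  simp only [h_det, Matrix.det_apply]
  exact Finset.measurable_sum _ fun σ _ =>
    (Finset.measurable_prod _ fun i _ => h_entry (σ i) i).const_smul _

end Jacobian

section InformationFlow

variable {Ω E V M M' : Type*} [MeasurableSpace E] [MeasurableSpace V] [MeasurableSpace M]
  [MeasurableSpace M'] {x : ℕ → Ω → E} {w : ℕ → Ω → V} {q' : ℕ → Ω → M'} {q : ℕ → Ω → M}

/-- The σ-algebra generated by the initial state, the first `k` noise terms and the first `t`
channel outputs. -/
abbrev past (x : ℕ → Ω → E) (w : ℕ → Ω → V) (q' : ℕ → Ω → M') (k t : ℕ) : MeasurableSpace Ω :=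
  MeasurableSpace.comap (fun ω => (x 0 ω, history w k ω, history q' t ω)) inferInstance

/-- The σ-algebra on which the channel law of `q'_t` is conditioned: it is generated by the initial
state, the whole noise sequence, the inputs up to time `t` and the outputs before time `t`. -/
abbrev channelInfo (x : ℕ → Ω → E) (w : ℕ → Ω → V) (q : ℕ → Ω → M) (q' : ℕ → Ω → M') (t : ℕ) :
    MeasurableSpace Ω :=
  MeasurableSpace.comap
    (fun ω => ((x 0 ω, fun r => w r ω), (history q (t + 1) ω, history q' t ω))) inferInstance

lemma past_le_iff {m : MeasurableSpace Ω} {k t : ℕ} : past x w q' k t ≤ m ↔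
    Measurable[m] (x 0) ∧ (∀ i < k, Measurable[m] (w i)) ∧ ∀ i < t, Measurable[m] (q' i) := by
  rw [past, ← measurable_iff_comap_le]
  refine ⟨fun h => ⟨measurable_fst.comp h, fun i hi => ?_, fun i hi => ?_⟩, fun ⟨hx, hw, hq'⟩ =>
    hx.prodMk ((measurable_history hw).prodMk (measurable_history hq'))⟩
  · exact (measurable_pi_apply (⟨i, hi⟩ : Fin k)).comp (measurable_fst.comp (measurable_snd.comp h))
  · exact (measurable_pi_apply (⟨i, hi⟩ : Fin t)).comp (measurable_snd.comp (measurable_snd.comp h))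

lemma past_mono {k k' t t' : ℕ} (hk : k ≤ k') (ht : t ≤ t') :
    past x w q' k t ≤ past x w q' k' t' := by
  obtain ⟨hx, hw, hq'⟩ := past_le_iff.1 (le_refl (past x w q' k' t'))
  exact past_le_iff.2 ⟨hx, fun i hi => hw i (hi.trans_le hk), fun i hi => hq' i (hi.trans_le ht)⟩

lemma measurable_outputs_past (k t : ℕ) : Measurable[past x w q' k t] (history q' t) :=
  measurable_history (past_le_iff.1 le_rfl).2.2

lemma measurable_noise_channelInfo (r t : ℕ) : Measurable[channelInfo x w q q' t] (w r) := by
  have h_noise : Measurable[channelInfo x w q q' t] fun ω r => w r ω :=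
    measurable_snd.comp (measurable_fst.comp (comap_measurable _))
  exact (measurable_pi_apply r).comp h_noise

lemma measurable_inputs_channelInfo (t : ℕ) :
    Measurable[channelInfo x w q q' t] (history q (t + 1)) :=
  measurable_fst.comp (measurable_snd.comp (comap_measurable _))

lemma measurable_outputs_channelInfo (t : ℕ) :
    Measurable[channelInfo x w q q' t] (history q' t) :=
  measurable_snd.comp (measurable_snd.comp (comap_measurable _))

lemma past_le_channelInfo (k t : ℕ) : past x w q' k t ≤ channelInfo x w q q' t :=
  past_le_iff.2 ⟨measurable_fst.comp (measurable_fst.comp (comap_measurable _)),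
    fun i _ => measurable_noise_channelInfo i t,
    fun i hi => (measurable_pi_apply (⟨i, hi⟩ : Fin t)).comp (measurable_outputs_channelInfo t)⟩

end InformationFlow

section PathWeight

variable {Ω M M' : Type*} {N d : ℕ}

/-- The weight `p₀(x₀)⁻¹ ∏_{t < T} |J(f(x_t, w_t))| / κ_t(q'_t | q_{[0,t]}, q'_{[0,t-1]})`: for
fixed noise and fixed outputs it turns the law of the path into Lebesgue measure in the variable
`x_T`. -/
noncomputable def pathWeight [MeasurableSpace Ω] (P : Measure Ω) (f : Vec N → Vec d → Vec N)
    (ch : Channel M M') (x : ℕ → Ω → Vec N) (w : ℕ → Ω → Vec d) (q : ℕ → Ω → M) (q' : ℕ → Ω → M')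
    (T : ℕ) (ω : Ω) : ENNReal :=
  (densityAt P (x 0) ω)⁻¹ * ∏ t ∈ Finset.range T,
    (ENNReal.ofReal |jacobian f (x t ω) (w t ω)| * (channelProb ch q q' t ω)⁻¹)

variable [MeasurableSpace Ω] {P : Measure Ω} {f : Vec N → Vec d → Vec N} {ch : Channel M M'}
  {x : ℕ → Ω → Vec N} {w : ℕ → Ω → Vec d} {q : ℕ → Ω → M} {q' : ℕ → Ω → M'}

lemma pathWeight_zero (ω : Ω) : pathWeight P f ch x w q q' 0 ω = (densityAt P (x 0) ω)⁻¹ := by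
  simp [pathWeight]

lemma pathWeight_succ (T : ℕ) (ω : Ω) :
    pathWeight P f ch x w q q' (T + 1) ω = pathWeight P f ch x w q q' T ω *
      (ENNReal.ofReal |jacobian f (x T ω) (w T ω)| * (channelProb ch q q' T ω)⁻¹) := by
  rw [pathWeight, Finset.prod_range_succ, ← mul_assoc, pathWeight]

variable {T : ℕ} {ω : Ω}

lemma pathWeight_ne_zero (h_density : densityAt P (x 0) ω ≠ ⊤)
    (h_jac : ∀ t ∈ Finset.range T, jacobian f (x t ω) (w t ω) ≠ 0) :
    pathWeight P f ch x w q q' T ω ≠ 0 :=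
  mul_ne_zero (ENNReal.inv_ne_zero.2 h_density) (Finset.prod_ne_zero_iff.2 fun t ht =>
    mul_ne_zero (ENNReal.ofReal_pos.2 (abs_pos.2 (h_jac t ht))).ne'
      (ENNReal.inv_ne_zero.2 (PMF.apply_ne_top _ _)))

lemma pathWeight_ne_top (h_density : densityAt P (x 0) ω ≠ 0)
    (h_ch : ∀ t ∈ Finset.range T, channelProb ch q q' t ω ≠ 0) :
    pathWeight P f ch x w q q' T ω ≠ ⊤ :=
  ENNReal.mul_ne_top (ENNReal.inv_ne_top.2 h_density) (ENNReal.prod_ne_top fun t ht =>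
    ENNReal.mul_ne_top ENNReal.ofReal_ne_top (ENNReal.inv_ne_top.2 (h_ch t ht)))

lemma logb_toReal_pathWeight (h_density : densityAt P (x 0) ω ≠ 0 ∧ densityAt P (x 0) ω ≠ ⊤)
    (h_jac : ∀ t ∈ Finset.range T, jacobian f (x t ω) (w t ω) ≠ 0)
    (h_ch : ∀ t ∈ Finset.range T, channelProb ch q q' t ω ≠ 0) :
    Real.logb 2 (pathWeight P f ch x w q q' T ω).toReal =
      ∑ t ∈ Finset.range T, Real.logb 2 |jacobian f (x t ω) (w t ω)| -
        ∑ t ∈ Finset.range T, Real.logb 2 (channelProb ch q q' t ω).toReal -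
        Real.logb 2 (densityAt P (x 0) ω).toReal := by
  have h_jac' : ∀ t ∈ Finset.range T, |jacobian f (x t ω) (w t ω)| ≠ 0 := fun t ht =>
    abs_ne_zero.2 (h_jac t ht)
  have h_ch' : ∀ t ∈ Finset.range T, (channelProb ch q q' t ω).toReal⁻¹ ≠ 0 := fun t ht =>
    inv_ne_zero (ENNReal.toReal_ne_zero.2 ⟨h_ch t ht, PMF.apply_ne_top _ _⟩)
  have h_prod := fun t ht => mul_ne_zero (h_jac' t ht) (h_ch' t ht)
  have h_toReal : (pathWeight P f ch x w q q' T ω).toReal = (densityAt P (x 0) ω).toReal⁻¹ *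
      ∏ t ∈ Finset.range T,
        (|jacobian f (x t ω) (w t ω)| * (channelProb ch q q' t ω).toReal⁻¹) := by
    simp only [pathWeight, ENNReal.toReal_mul, ENNReal.toReal_prod, ENNReal.toReal_inv,
      ENNReal.toReal_ofReal (abs_nonneg _)]
  rw [h_toReal, Real.logb_mul (inv_ne_zero (ENNReal.toReal_ne_zero.2 h_density))
    (Finset.prod_ne_zero_iff.2 h_prod), Real.logb_prod _ _ h_prod, Real.logb_inv,
    Finset.sum_congr rfl fun t ht => Real.logb_mul (h_jac' t ht) (h_ch' t ht)]
  simp only [Real.logb_inv, Finset.sum_add_distrib, Finset.sum_neg_distrib]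
  ring

/-- The ratio `p_T(x_T) P(q'_{[0,T-1]}) ∏_{t < T} |J(f(x_t, w_t))| / (p₀(x₀) ∏_{t < T} κ_t(q'_t))`.
It compares the product of the laws of `x_T`, of the outputs and of the noise with their joint law,
both expressed in the variables `x_T, q', w` that determine the path. -/
noncomputable def likelihoodRatio (P : Measure Ω) (f : Vec N → Vec d → Vec N) (ch : Channel M M')
    (x : ℕ → Ω → Vec N) (w : ℕ → Ω → Vec d) (q : ℕ → Ω → M) (q' : ℕ → Ω → M') (T : ℕ) (ω : Ω) :
    ENNReal :=
  densityAt P (x T) ω * (massAt P (history q' T) ω * pathWeight P f ch x w q q' T ω)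

lemma sum_log2Abs_jacobian_add_le [IsFiniteMeasure P] (h_mass : massAt P (history q' T) ω ≠ 0)
    (h_density₀ : densityAt P (x 0) ω ≠ 0 ∧ densityAt P (x 0) ω ≠ ⊤)
    (h_density : densityAt P (x T) ω ≠ 0 ∧ densityAt P (x T) ω ≠ ⊤)
    (h_jac : ∀ t ∈ Finset.range T, jacobian f (x t ω) (w t ω) ≠ 0)
    (h_ch : ∀ t ∈ Finset.range T, channelProb ch q q' t ω ≠ 0) :
    ∑ t ∈ Finset.range T, log2Abs (jacobian f (x t ω) (w t ω)) +
        ((-Real.logb 2 (densityAt P (x 0) ω).toReal : ℝ) : EReal) ≤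
      ((-Real.logb 2 (densityAt P (x T) ω).toReal : ℝ) : EReal) +
        ((directedInfoDensity P ch q q' T ω +
          ((likelihoodRatio P f ch x w q q' T ω).toReal - 1) / Real.log 2 : ℝ) : EReal) := by
  have h_density_ne : (densityAt P (x T) ω).toReal ≠ 0 := ENNReal.toReal_ne_zero.2 h_density
  have h_mass_ne : (massAt P (history q' T) ω).toReal ≠ 0 :=
    ENNReal.toReal_ne_zero.2 ⟨h_mass, massAt_ne_top _ ω⟩
  have h_weight_ne : (pathWeight P f ch x w q q' T ω).toReal ≠ 0 :=
    ENNReal.toReal_ne_zero.2 ⟨pathWeight_ne_zero h_density₀.2 h_jac,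
      pathWeight_ne_top h_density₀.1 h_ch⟩
  have h_logb : Real.logb 2 (likelihoodRatio P f ch x w q q' T ω).toReal =
      Real.logb 2 (densityAt P (x T) ω).toReal + (Real.logb 2 (massAt P (history q' T) ω).toReal +
        Real.logb 2 (pathWeight P f ch x w q q' T ω).toReal) := by
    rw [likelihoodRatio, ENNReal.toReal_mul, ENNReal.toReal_mul,
      Real.logb_mul h_density_ne (mul_ne_zero h_mass_ne h_weight_ne),
      Real.logb_mul h_mass_ne h_weight_ne]
  have h_gibbs : Real.logb 2 (likelihoodRatio P f ch x w q q' T ω).toReal ≤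
      ((likelihoodRatio P f ch x w q q' T ω).toReal - 1) / Real.log 2 := by
    refine div_le_div_of_nonneg_right (Real.log_le_sub_one_of_pos ?_) (Real.log_nonneg one_le_two)
    rw [likelihoodRatio, ENNReal.toReal_mul, ENNReal.toReal_mul]
    positivity
  rw [h_logb, logb_toReal_pathWeight h_density₀ h_jac h_ch] at h_gibbs
  rw [sum_log2Abs_of_ne_zero h_jac, ← EReal.coe_add, ← EReal.coe_add, EReal.coe_le_coe_iff,
    directedInfoDensity]
  linarith

end PathWeight

namespace IsClosedLoop

section Causality

variable {N d s : ℕ} {M M' : Type*} [MeasurableSpace M] [MeasurableSpace M']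
  {Ω : Type*} [MeasurableSpace Ω] {P : Measure Ω}
  {f : Vec N → Vec d → Vec N} {B : Matrix (Fin N) (Fin s) ℝ} {ν : Measure (Vec d)}
  {ch : Channel M M'} {γe : CodingPolicy N M M'} {γ : ControlPolicy s M'}
  {x : ℕ → Ω → Vec N} {w : ℕ → Ω → Vec d} {q : ℕ → Ω → M} {q' : ℕ → Ω → M'}

lemma past_le (h : IsClosedLoop P f B ν ch γe γ x w q q') (k t : ℕ) :
    past x w q' k t ≤ ‹MeasurableSpace Ω› :=
  past_le_iff.2 ⟨h.measurable_init, fun i _ => h.measurable_noise i,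
    fun i _ => h.measurable_output i⟩

variable [Finite M'] [MeasurableSingletonClass M']

lemma measurable_state_past (h : IsClosedLoop P f B ν ch γe γ x w q q')
    (hf : Measurable (Function.uncurry f)) (t : ℕ) : Measurable[past x w q' t t] (x t) := by
  induction t with
  | zero => exact (past_le_iff.1 le_rfl).1
  | succ t ih =>
    obtain ⟨-, hw, hq'⟩ := past_le_iff.1 (le_refl (past x w q' (t + 1) (t + 1)))
    have h_state := ih.mono (past_mono t.le_succ t.le_succ) le_rfl
    have h_control : Measurable fun b => Matrix.toEuclideanLin B (γ t b) := .of_discrete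
    rw [funext (h.state_eq t)]
    exact (hf.comp (h_state.prodMk (hw t t.lt_succ_self))).add
      (h_control.comp (measurable_history hq'))

lemma measurable_input_past (h : IsClosedLoop P f B ν ch γe γ x w q q')
    (hf : Measurable (Function.uncurry f)) (hγe : ∀ t, Measurable (Function.uncurry (γe t)))
    (t : ℕ) : Measurable[past x w q' t t] (q t) := by
  have h_states : Measurable[past x w q' t t] (history x (t + 1)) := measurable_history fun i hi =>
    (h.measurable_state_past hf i).mono (past_mono (Nat.le_of_lt_succ hi) (Nat.le_of_lt_succ hi))
      le_rfl
  rw [funext (h.input_eq t)]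
  exact (hγe t).comp (h_states.prodMk (measurable_outputs_past t t))

lemma measurable_state (h : IsClosedLoop P f B ν ch γe γ x w q q')
    (hf : Measurable (Function.uncurry f)) (t : ℕ) : Measurable (x t) :=
  (h.measurable_state_past hf t).mono (h.past_le t t) le_rfl

lemma measurable_input (h : IsClosedLoop P f B ν ch γe γ x w q q')
    (hf : Measurable (Function.uncurry f)) (hγe : ∀ t, Measurable (Function.uncurry (γe t)))
    (t : ℕ) : Measurable (q t) :=
  (h.measurable_input_past hf hγe t).mono (h.past_le t t) le_rfl

lemma measurable_inputs_past (h : IsClosedLoop P f B ν ch γe γ x w q q')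
    (hf : Measurable (Function.uncurry f)) (hγe : ∀ t, Measurable (Function.uncurry (γe t)))
    (t : ℕ) : Measurable[past x w q' t t] (history q (t + 1)) :=
  measurable_history fun i hi => (h.measurable_input_past hf hγe i).mono
    (past_mono (Nat.le_of_lt_succ hi) (Nat.le_of_lt_succ hi)) le_rfl

lemma channelInfo_le (h : IsClosedLoop P f B ν ch γe γ x w q q')
    (hf : Measurable (Function.uncurry f)) (hγe : ∀ t, Measurable (Function.uncurry (γe t)))
    (t : ℕ) : channelInfo x w q q' t ≤ ‹MeasurableSpace Ω› :=
  Measurable.comap_le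
    ((h.measurable_init.prodMk (measurable_pi_lambda _ h.measurable_noise)).prodMk
      ((measurable_history fun i _ => h.measurable_input hf hγe i).prodMk
        (measurable_history fun i _ => h.measurable_output i)))

end Causality

section Channel

variable {N d s : ℕ} {M M' : Type*} [MeasurableSpace M] [MeasurableSpace M']
  {Ω : Type*} [MeasurableSpace Ω]
  {P : Measure Ω} [IsProbabilityMeasure P] {f : Vec N → Vec d → Vec N}
  {B : Matrix (Fin N) (Fin s) ℝ} {ν : Measure (Vec d)} {ch : Channel M M'}
  {γe : CodingPolicy N M M'} {γ : ControlPolicy s M'} {x : ℕ → Ω → Vec N} {w : ℕ → Ω → Vec d}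
  {q : ℕ → Ω → M} {q' : ℕ → Ω → M'}

lemma indepFun_noise_source (h : IsClosedLoop P f B ν ch γe γ x w q q') (t : ℕ) :
    IndepFun (fun ω => (x 0 ω, history w t ω)) (w t) P := by
  have h_history : IndepFun (history w t) (w t) P :=
    (h.noise_indep.indepFun_finset (Finset.range t) {t} (by simp) h.measurable_noise).comp
      (φ := fun (v : Finset.range t → Vec d) (i : Fin t) => v ⟨i, Finset.mem_range.2 i.isLt⟩)
      (ψ := fun v : ({t} : Finset ℕ) → Vec d => v ⟨t, Finset.mem_singleton_self t⟩)
      (by fun_prop) (by fun_prop)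
  have h_init : IndepFun (x 0) (fun ω => (history w t ω, w t ω)) P :=
    h.init_indep.comp (φ := id) (ψ := fun v : ℕ → Vec d => (fun i : Fin t => v i, v t))
      measurable_id (by fun_prop)
  exact indepFun_prodMk_left h.measurable_init
    (measurable_history fun i _ => h.measurable_noise i) (h.measurable_noise t) h_init h_history

variable [Finite M'] [MeasurableSingletonClass M']

lemma setLIntegral_output (h : IsClosedLoop P f B ν ch γe γ x w q q')
    (hf : Measurable (Function.uncurry f)) (hγe : ∀ t, Measurable (Function.uncurry (γe t)))
    {t : ℕ} (b : M') {G : Ω → ENNReal} (hG : Measurable[channelInfo x w q q' t] G) :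
    ∫⁻ ω in q' t ⁻¹' {b}, G ω ∂P =
      ∫⁻ ω, ch t (history q (t + 1) ω) (history q' t ω) b * G ω ∂P := by
  rw [setLIntegral_eq_lintegral_condExp_mul (h.channelInfo_le hf hγe t)
    (h.measurable_output t (measurableSet_singleton b)) hG]
  refine lintegral_congr_ae ?_
  filter_upwards [h.output_law t b] with ω hω
  rw [hω, ENNReal.ofReal_toReal (PMF.apply_ne_top _ _)]

lemma measure_inter_output (h : IsClosedLoop P f B ν ch γe γ x w q q')
    (hf : Measurable (Function.uncurry f)) (hγe : ∀ t, Measurable (Function.uncurry (γe t)))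
    {t : ℕ} (b : M') {A : Set Ω} (hA : MeasurableSet[channelInfo x w q q' t] A) :
    P (A ∩ q' t ⁻¹' {b}) = ∫⁻ ω in A, ch t (history q (t + 1) ω) (history q' t ω) b ∂P := by
  have hA_meas := h.channelInfo_le hf hγe t A hA
  calc P (A ∩ q' t ⁻¹' {b})
      = ∫⁻ ω in q' t ⁻¹' {b}, A.indicator (fun _ => 1) ω ∂P := by
        rw [lintegral_indicator_const hA_meas, one_mul, Measure.restrict_apply hA_meas]
    _ = ∫⁻ ω, ch t (history q (t + 1) ω) (history q' t ω) b * A.indicator (fun _ => 1) ω ∂P :=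
        h.setLIntegral_output hf hγe b (Measurable.indicator (@measurable_const _ _ _ (_) 1) hA)
    _ = ∫⁻ ω in A, ch t (history q (t + 1) ω) (history q' t ω) b ∂P := by
        rw [← lintegral_indicator hA_meas]
        refine lintegral_congr fun ω => ?_
        by_cases hω : ω ∈ A <;> simp [hω]

variable [MeasurableSingletonClass M]

lemma measure_history_inter_output (h : IsClosedLoop P f B ν ch γe γ x w q q')
    (hf : Measurable (Function.uncurry f)) (hγe : ∀ t, Measurable (Function.uncurry (γe t)))
    (t : ℕ) (a : Fin (t + 1) → M) (u : Fin t → M') (b : M') :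
    P (history q (t + 1) ⁻¹' {a} ∩ history q' t ⁻¹' {u} ∩ q' t ⁻¹' {b}) =
      ch t a u b * P (history q (t + 1) ⁻¹' {a} ∩ history q' t ⁻¹' {u}) := by
  have h_info : MeasurableSet[channelInfo x w q q' t]
      (history q (t + 1) ⁻¹' {a} ∩ history q' t ⁻¹' {u}) :=
    (measurable_inputs_channelInfo t (measurableSet_singleton a)).inter
      (measurable_outputs_channelInfo t (measurableSet_singleton u))
  rw [h.measure_inter_output hf hγe b h_info, ← setLIntegral_const]
  refine setLIntegral_congr_fun (h.channelInfo_le hf hγe t _ h_info) fun ω hω => ?_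
  rw [show history q (t + 1) ω = a from hω.1, show history q' t ω = u from hω.2]

variable [Finite M]

lemma setLIntegral_mul_inv_channelProb_le (h : IsClosedLoop P f B ν ch γe γ x w q q')
    (hf : Measurable (Function.uncurry f)) (hγe : ∀ t, Measurable (Function.uncurry (γe t)))
    {t : ℕ} (b : M') {G : Ω → ENNReal} (hG : Measurable[channelInfo x w q q' t] G) :
    ∫⁻ ω in q' t ⁻¹' {b}, G ω * (channelProb ch q q' t ω)⁻¹ ∂P ≤ ∫⁻ ω, G ω ∂P := by
  have h_ch : Measurable[channelInfo x w q q' t] fun ω =>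
      ch t (history q (t + 1) ω) (history q' t ω) b :=
    Measurable.comp (g := fun z : (Fin (t + 1) → M) × (Fin t → M') => ch t z.1 z.2 b)
      .of_discrete ((measurable_inputs_channelInfo t).prodMk (measurable_outputs_channelInfo t))
  calc ∫⁻ ω in q' t ⁻¹' {b}, G ω * (channelProb ch q q' t ω)⁻¹ ∂P
      = ∫⁻ ω in q' t ⁻¹' {b}, G ω * (ch t (history q (t + 1) ω) (history q' t ω) b)⁻¹ ∂P :=
        setLIntegral_congr_fun (h.measurable_output t (measurableSet_singleton b)) fun ω hω => by
          rw [channelProb, show q' t ω = b from hω]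
    _ = ∫⁻ ω, ch t (history q (t + 1) ω) (history q' t ω) b *
          (G ω * (ch t (history q (t + 1) ω) (history q' t ω) b)⁻¹) ∂P :=
        h.setLIntegral_output hf hγe b (hG.mul h_ch.inv)
    _ ≤ ∫⁻ ω, G ω ∂P := lintegral_mono fun ω => by
        rw [mul_left_comm]
        exact mul_le_of_le_one_right zero_le (ENNReal.mul_inv_le_one _)

lemma ae_channelProb_ne_zero (h : IsClosedLoop P f B ν ch γe γ x w q q')
    (hf : Measurable (Function.uncurry f)) (hγe : ∀ t, Measurable (Function.uncurry (γe t)))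
    (t : ℕ) : ∀ᵐ ω ∂P, channelProb ch q q' t ω ≠ 0 := by
  filter_upwards [ae_massAt_ne_zero fun ω => (history q (t + 1) ω, history q' t ω, q' t ω)]
    with ω h_mass h_zero
  refine h_mass (measure_mono_null (fun ω' h_mem => ?_)
    ((h.measure_history_inter_output hf hγe t _ _ _).trans (mul_eq_zero_of_left h_zero _)))
  simpa [and_assoc] using h_mem

/-- Given the past, the output `q'_i` depends on `w_t` through the channel inputs only, and for
`i < t` these are determined by the past. -/
lemma measure_inter_output_inter_noise (h : IsClosedLoop P f B ν ch γe γ x w q q')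
    (hf : Measurable (Function.uncurry f)) (hγe : ∀ t, Measurable (Function.uncurry (γe t)))
    {i t : ℕ} (hit : i ≤ t)
    (h_indep : Indep (past x w q' t i) (MeasurableSpace.comap (w t) inferInstance) P) (b : M')
    {A C : Set Ω} (hA : MeasurableSet[past x w q' t i] A)
    (hC : MeasurableSet[MeasurableSpace.comap (w t) inferInstance] C) :
    P (A ∩ q' i ⁻¹' {b} ∩ C) = P (A ∩ q' i ⁻¹' {b}) * P C := by
  have h_ch : Measurable[past x w q' t i] fun ω =>
      ch i (history q (i + 1) ω) (history q' i ω) b :=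
    Measurable.comp (g := fun z : (Fin (i + 1) → M) × (Fin i → M') => ch i z.1 z.2 b)
      .of_discrete (((h.measurable_inputs_past hf hγe i).mono (past_mono hit le_rfl) le_rfl).prodMk
        (measurable_outputs_past t i))
  have hA_info := past_le_channelInfo (q := q) t i A hA
  have hC_info := (measurable_noise_channelInfo (x := x) (q := q) (q' := q') t i).comap_le C hC
  rw [Set.inter_right_comm, h.measure_inter_output hf hγe b (hA_info.inter hC_info),
    setLIntegral_inter_of_indep h_indep (h.past_le t i) (h.measurable_noise t).comap_le hA hC h_ch,
    h.measure_inter_output hf hγe b hA_info]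

lemma indep_past_noise (h : IsClosedLoop P f B ν ch γe γ x w q q')
    (hf : Measurable (Function.uncurry f)) (hγe : ∀ t, Measurable (Function.uncurry (γe t)))
    {i t : ℕ} (hit : i ≤ t) :
    Indep (past x w q' t i) (MeasurableSpace.comap (w t) inferInstance) P := by
  induction i with
  | zero =>
    have h_past : past x w q' t 0 ≤
        MeasurableSpace.comap (fun ω => (x 0 ω, history w t ω)) inferInstance := by
      have h_history : Measurable[MeasurableSpace.comap (fun ω => (x 0 ω, history w t ω))
          inferInstance] (history w t) := measurable_snd.comp (comap_measurable _)
      exact past_le_iff.2 ⟨measurable_fst.comp (comap_measurable _), fun i hi =>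
        (measurable_pi_apply (⟨i, hi⟩ : Fin t)).comp h_history,
        fun i hi => absurd hi i.not_lt_zero⟩
    exact indep_of_indep_of_le_left (h.indepFun_noise_source t) h_past
  | succ i ih =>
    have h_past : past x w q' t (i + 1) ≤
        past x w q' t i ⊔ MeasurableSpace.comap (q' i) inferInstance := by
      obtain ⟨hx, hw, hq'⟩ := past_le_iff.1 (le_refl (past x w q' t i))
      refine past_le_iff.2 ⟨hx.mono le_sup_left le_rfl,
        fun j hj => (hw j hj).mono le_sup_left le_rfl, fun j hj => ?_⟩
      rcases Nat.lt_succ_iff_lt_or_eq.1 hj with hj | rfl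
      · exact (hq' j hj).mono le_sup_left le_rfl
      · exact (comap_measurable (q' j)).mono le_sup_right le_rfl
    have hit' := Nat.le_of_succ_le hit
    exact indep_of_indep_of_le_left (indep_sup_comap_of_countable (h.past_le t i)
      (h.measurable_noise t).comap_le (h.measurable_output i) fun b A C hA hC =>
        h.measure_inter_output_inter_noise hf hγe hit' (ih hit') b hA hC) h_past

lemma indepFun_noise (h : IsClosedLoop P f B ν ch γe γ x w q q')
    (hf : Measurable (Function.uncurry f)) (hγe : ∀ t, Measurable (Function.uncurry (γe t)))
    {t : ℕ} {α : Type*} [MeasurableSpace α] {X : Ω → α} (hX : Measurable[past x w q' t t] X) :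
    IndepFun X (w t) P :=
  indep_of_indep_of_le_left (h.indep_past_noise hf hγe le_rfl) hX.comap_le

lemma map_state_noise (h : IsClosedLoop P f B ν ch γe γ x w q q')
    (hf : Measurable (Function.uncurry f)) (hγe : ∀ t, Measurable (Function.uncurry (γe t)))
    (t : ℕ) : P.map (fun ω => (x t ω, w t ω)) = (P.map (x t)).prod ν := by
  rw [← h.noise_law t]
  exact (indepFun_iff_map_prod_eq_prod_map_map (h.measurable_state hf t).aemeasurable
    (h.measurable_noise t).aemeasurable).1 (h.indepFun_noise hf hγe (h.measurable_state_past hf t))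

end Channel

section ChangeOfMeasure

variable {N d s : ℕ} {M M' : Type*} [MeasurableSpace M]
  [Finite M'] [MeasurableSpace M'] [MeasurableSingletonClass M']
  {Ω : Type*} [MeasurableSpace Ω] {P : Measure Ω} {f : Vec N → Vec d → Vec N}
  {B : Matrix (Fin N) (Fin s) ℝ} {ν : Measure (Vec d)} {ch : Channel M M'}
  {γe : CodingPolicy N M M'} {γ : ControlPolicy s M'} {x : ℕ → Ω → Vec N} {w : ℕ → Ω → Vec d}
  {q : ℕ → Ω → M} {q' : ℕ → Ω → M'} {T : ℕ}

lemma measurable_log2Abs_jacobian (h : IsClosedLoop P f B ν ch γe γ x w q q')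
    (hf : Measurable (Function.uncurry f)) (hf_diff : ∀ v, Differentiable ℝ fun y => f y v)
    (t : ℕ) : Measurable fun ω => log2Abs (jacobian f (x t ω) (w t ω)) :=
  (measurable_log2Abs.comp (measurable_jacobian hf hf_diff)).comp
    ((h.measurable_state hf t).prodMk (h.measurable_noise t))

variable [Finite M] [MeasurableSingletonClass M]

lemma measurable_channelProb_past (h : IsClosedLoop P f B ν ch γe γ x w q q')
    (hf : Measurable (Function.uncurry f)) (hγe : ∀ t, Measurable (Function.uncurry (γe t)))
    (t : ℕ) : Measurable[past x w q' (t + 1) (t + 1)] (channelProb ch q q' t) := by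
  have h_mono : past x w q' t t ≤ past x w q' (t + 1) (t + 1) := past_mono t.le_succ t.le_succ
  have h_output := (past_le_iff.1 (le_refl (past x w q' (t + 1) (t + 1)))).2.2 t t.lt_succ_self
  exact Measurable.comp
    (g := fun z : ((Fin (t + 1) → M) × (Fin t → M')) × M' => ch t z.1.1 z.1.2 z.2) .of_discrete
    ((((h.measurable_inputs_past hf hγe t).mono h_mono le_rfl).prodMk
      ((measurable_outputs_past t t).mono h_mono le_rfl)).prodMk h_output)

lemma measurable_pathWeight_past (h : IsClosedLoop P f B ν ch γe γ x w q q')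
    (hf : Measurable (Function.uncurry f)) (hf_diff : ∀ v, Differentiable ℝ fun y => f y v)
    (hγe : ∀ t, Measurable (Function.uncurry (γe t))) (T : ℕ) :
    Measurable[past x w q' T T] (pathWeight P f ch x w q q' T) := by
  obtain ⟨h_init, h_noise, -⟩ := past_le_iff.1 (le_refl (past x w q' T T))
  refine (measurable_densityAt h_init).inv.mul (Finset.measurable_prod _ fun t ht => ?_)
  have ht' := Finset.mem_range.1 ht
  have h_state : Measurable[past x w q' T T] (x t) :=
    (h.measurable_state_past hf t).mono (past_mono ht'.le ht'.le) le_rfl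
  have h_jac : Measurable[past x w q' T T] fun ω =>
      ENNReal.ofReal |jacobian f (x t ω) (w t ω)| :=
    (measurable_jacobian hf hf_diff).abs.ennreal_ofReal.comp (h_state.prodMk (h_noise t ht'))
  exact h_jac.mul ((h.measurable_channelProb_past hf hγe t).mono (past_mono ht' ht') le_rfl).inv

lemma measurable_pathWeight (h : IsClosedLoop P f B ν ch γe γ x w q q')
    (hf : Measurable (Function.uncurry f)) (hf_diff : ∀ v, Differentiable ℝ fun y => f y v)
    (hγe : ∀ t, Measurable (Function.uncurry (γe t))) (T : ℕ) :
    Measurable (pathWeight P f ch x w q q' T) :=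
  (h.measurable_pathWeight_past hf hf_diff hγe T).mono (h.past_le T T) le_rfl

lemma measurable_massAt_mul_pathWeight (h : IsClosedLoop P f B ν ch γe γ x w q q')
    (hf : Measurable (Function.uncurry f)) (hf_diff : ∀ v, Differentiable ℝ fun y => f y v)
    (hγe : ∀ t, Measurable (Function.uncurry (γe t))) (T : ℕ) :
    Measurable fun ω => massAt P (history q' T) ω * pathWeight P f ch x w q q' T ω :=
  (measurable_massAt (measurable_history fun i _ => h.measurable_output i)).mul
    (h.measurable_pathWeight hf hf_diff hγe T)

lemma measurable_likelihoodRatio (h : IsClosedLoop P f B ν ch γe γ x w q q')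
    (hf : Measurable (Function.uncurry f)) (hf_diff : ∀ v, Differentiable ℝ fun y => f y v)
    (hγe : ∀ t, Measurable (Function.uncurry (γe t))) :
    Measurable (likelihoodRatio P f ch x w q q' T) :=
  (measurable_densityAt (h.measurable_state hf T)).mul
    (h.measurable_massAt_mul_pathWeight hf hf_diff hγe T)

variable [IsProbabilityMeasure P]

lemma expLogJacobian_eq_extIntegral (h : IsClosedLoop P f B ν ch γe γ x w q q')
    (hf : Measurable (Function.uncurry f)) (hf_diff : ∀ v, Differentiable ℝ fun y => f y v)
    (hγe : ∀ t, Measurable (Function.uncurry (γe t))) (t : ℕ) :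
    expLogJacobian f (P.map (x t)) ν =
      extIntegral P fun ω => log2Abs (jacobian f (x t ω) (w t ω)) := by
  rw [expLogJacobian, ← h.map_state_noise hf hγe t]
  exact extIntegral_map ((h.measurable_state hf t).prodMk (h.measurable_noise t)).aemeasurable
    (measurable_log2Abs.comp (measurable_jacobian hf hf_diff))

lemma ae_jacobian_ne_zero_of_expLogJacobian_ne_bot (h : IsClosedLoop P f B ν ch γe γ x w q q')
    (hf : Measurable (Function.uncurry f)) (hf_diff : ∀ v, Differentiable ℝ fun y => f y v)
    (hγe : ∀ t, Measurable (Function.uncurry (γe t))) {t : ℕ}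
    (h_log : expLogJacobian f (P.map (x t)) ν ≠ ⊥) :
    ∀ᵐ ω ∂P, jacobian f (x t ω) (w t ω) ≠ 0 := by
  rw [h.expLogJacobian_eq_extIntegral hf hf_diff hγe] at h_log
  filter_upwards [ae_ne_bot_of_extIntegral_ne_bot
    (h.measurable_log2Abs_jacobian hf hf_diff t).aemeasurable h_log] with ω hω
  exact mt log2Abs_eq_bot_iff.2 hω

lemma setLIntegral_comp_state_noise_mul (h : IsClosedLoop P f B ν ch γe γ x w q q')
    (hf : Measurable (Function.uncurry f)) (hγe : ∀ t, Measurable (Function.uncurry (γe t)))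
    {T : ℕ} {A : Set Ω} (hA : MeasurableSet[past x w q' T T] A) {R : Ω → ENNReal}
    (hR : Measurable[past x w q' T T] R) {k : Vec N × Vec d → ENNReal} (hk : Measurable k) :
    ∫⁻ ω in A, k (x T ω, w T ω) * R ω ∂P = ∫⁻ v, ∫⁻ ω in A, k (x T ω, v) * R ω ∂P ∂ν := by
  have hA_meas := h.past_le T T A hA
  have h_pair : Measurable[past x w q' T T] fun ω => (x T ω, A.indicator R ω) :=
    (h.measurable_state_past hf T).prodMk (hR.indicator hA)
  have h_weighted : Measurable fun z : (Vec N × ENNReal) × Vec d => k (z.1.1, z.2) * z.1.2 :=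
    (hk.comp (measurable_fst.fst.prodMk measurable_snd)).mul measurable_fst.snd
  simp only [← lintegral_indicator hA_meas, Set.indicator_mul_right, ← h.noise_law T]
  exact lintegral_comp_of_indepFun (h_pair.mono (h.past_le T T) le_rfl) (h.measurable_noise T)
    (h.indepFun_noise hf hγe h_pair) h_weighted

/-- The channel factor of the weight cancels the law of the output `q'_T`, after which the control
`u_T` is a constant `c`. -/
lemma setLIntegral_succ_mul_pathWeight_le (h : IsClosedLoop P f B ν ch γe γ x w q q')
    (hf : Measurable (Function.uncurry f)) (hf_diff : ∀ v, Differentiable ℝ fun y => f y v)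
    (hγe : ∀ t, Measurable (Function.uncurry (γe t))) {T : ℕ} (b : Fin (T + 1) → M')
    {c : Vec N} (hc : Matrix.toEuclideanLin B (γ T b) = c)
    {g : Vec N → ENNReal} (hg : Measurable g) :
    ∫⁻ ω in history q' (T + 1) ⁻¹' {b}, g (x (T + 1) ω) * pathWeight P f ch x w q q' (T + 1) ω ∂P ≤
      ∫⁻ ω in history q' T ⁻¹' {Fin.init b}, g (f (x T ω) (w T ω) + c) *
        ENNReal.ofReal |jacobian f (x T ω) (w T ω)| * pathWeight P f ch x w q q' T ω ∂P := by
  set A := history q' T ⁻¹' {Fin.init b}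
  set D := q' T ⁻¹' {b (Fin.last T)}
  set G := fun ω => g (f (x T ω) (w T ω) + c) *
    ENNReal.ofReal |jacobian f (x T ω) (w T ω)| * pathWeight P f ch x w q q' T ω
  have h_split : history q' (T + 1) ⁻¹' {b} = A ∩ D := by
    ext ω
    simp only [A, D, Set.mem_preimage, Set.mem_singleton_iff, Set.mem_inter_iff, history_succ]
    rw [← Fin.snoc_init_self b, Fin.snoc_inj, Fin.init_snoc, Fin.snoc_last]
  have h_info := past_le_channelInfo (x := x) (w := w) (q := q) (q' := q') T T
  have hA : MeasurableSet[channelInfo x w q q' T] A :=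
    measurable_outputs_channelInfo T (measurableSet_singleton _)
  have hA_meas : MeasurableSet A := h.channelInfo_le hf hγe T A hA
  have hD : MeasurableSet D := h.measurable_output T (measurableSet_singleton _)
  have hG : Measurable[channelInfo x w q q' T] G := by
    have h_pair := ((h.measurable_state_past hf T).mono h_info le_rfl).prodMk
      (measurable_noise_channelInfo (q := q) T T)
    exact (((hg.comp (hf.add_const c)).mul
      (measurable_jacobian hf hf_diff).abs.ennreal_ofReal).comp h_pair).mul
      ((h.measurable_pathWeight_past hf hf_diff hγe T).mono h_info le_rfl)
  calc ∫⁻ ω in history q' (T + 1) ⁻¹' {b},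
        g (x (T + 1) ω) * pathWeight P f ch x w q q' (T + 1) ω ∂P
      = ∫⁻ ω in A ∩ D, G ω * (channelProb ch q q' T ω)⁻¹ ∂P := by
        rw [← h_split]
        refine setLIntegral_congr_fun (h_split ▸ hA_meas.inter hD) fun ω hω => ?_
        rw [h.state_eq, show history q' (T + 1) ω = b from hω, hc, pathWeight_succ]
        ring
    _ = ∫⁻ ω in D, A.indicator G ω * (channelProb ch q q' T ω)⁻¹ ∂P := by
        simp only [← Measure.restrict_restrict hA_meas, ← lintegral_indicator hA_meas,
          Set.indicator_mul_left]
    _ ≤ ∫⁻ ω, A.indicator G ω ∂P :=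
        h.setLIntegral_mul_inv_channelProb_le hf hγe _ (hG.indicator hA)
    _ = ∫⁻ ω in A, G ω ∂P := lintegral_indicator hA_meas G

lemma setLIntegral_comp_state_mul_pathWeight_le (h : IsClosedLoop P f B ν ch γe γ x w q q')
    (hf : Measurable (Function.uncurry f)) (hf_diff : ∀ v, Differentiable ℝ fun y => f y v)
    (hf_inj : ∀ v, Function.Injective fun y => f y v)
    (hγe : ∀ t, Measurable (Function.uncurry (γe t))) (hx₀ : P.map (x 0) ≪ volume)
    {T : ℕ} (b : Fin T → M') {g : Vec N → ENNReal} (hg : Measurable g) :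
    ∫⁻ ω in history q' T ⁻¹' {b}, g (x T ω) * pathWeight P f ch x w q q' T ω ∂P ≤
      ∫⁻ y, g y := by
  induction T generalizing g with
  | zero =>
    simp only [pathWeight_zero]
    exact (setLIntegral_le_lintegral _ _).trans
      (lintegral_comp_mul_inv_densityAt_le h.measurable_init hx₀ hg)
  | succ T ih =>
    set c := Matrix.toEuclideanLin B (γ T b) with hc
    have h_shift : Measurable fun y => g (y + c) := hg.comp (measurable_add_const c)
    have h_integrand : Measurable fun z : Vec N × Vec d =>
        g (f z.1 z.2 + c) * ENNReal.ofReal |jacobian f z.1 z.2| :=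
      (h_shift.comp hf).mul (measurable_jacobian hf hf_diff).abs.ennreal_ofReal
    have : IsProbabilityMeasure ν :=
      h.noise_law T ▸ Measure.isProbabilityMeasure_map (h.measurable_noise T).aemeasurable
    calc ∫⁻ ω in history q' (T + 1) ⁻¹' {b},
          g (x (T + 1) ω) * pathWeight P f ch x w q q' (T + 1) ω ∂P
        ≤ ∫⁻ ω in history q' T ⁻¹' {Fin.init b}, g (f (x T ω) (w T ω) + c) *
            ENNReal.ofReal |jacobian f (x T ω) (w T ω)| * pathWeight P f ch x w q q' T ω ∂P :=
          h.setLIntegral_succ_mul_pathWeight_le hf hf_diff hγe b hc.symm hg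
      _ = ∫⁻ v, ∫⁻ ω in history q' T ⁻¹' {Fin.init b}, g (f (x T ω) v + c) *
            ENNReal.ofReal |jacobian f (x T ω) v| * pathWeight P f ch x w q q' T ω ∂P ∂ν :=
          h.setLIntegral_comp_state_noise_mul hf hγe
            (measurable_outputs_past T T (measurableSet_singleton _))
            (h.measurable_pathWeight_past hf hf_diff hγe T) h_integrand
      _ ≤ ∫⁻ v, (∫⁻ y, g (f y v + c) * ENNReal.ofReal |jacobian f y v|) ∂ν :=
          lintegral_mono fun v => ih _ (h_integrand.comp measurable_prodMk_right)
      _ ≤ ∫⁻ _, (∫⁻ y, g (y + c)) ∂ν := lintegral_mono fun v =>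
          lintegral_comp_mul_jacobian_le (hf_diff v) (hf_inj v) fun y => g (y + c)
      _ = ∫⁻ y, g y := by
          rw [lintegral_const, measure_univ, mul_one, lintegral_add_right_eq_self]

lemma lintegral_comp_state_mul_massAt_mul_pathWeight_le (h : IsClosedLoop P f B ν ch γe γ x w q q')
    (hf : Measurable (Function.uncurry f)) (hf_diff : ∀ v, Differentiable ℝ fun y => f y v)
    (hf_inj : ∀ v, Function.Injective fun y => f y v)
    (hγe : ∀ t, Measurable (Function.uncurry (γe t))) (hx₀ : P.map (x 0) ≪ volume)
    {g : Vec N → ENNReal} (hg : Measurable g) :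
    ∫⁻ ω, g (x T ω) * (massAt P (history q' T) ω * pathWeight P f ch x w q q' T ω) ∂P ≤
      ∫⁻ y, g y := by
  cases nonempty_fintype M'
  have h_outputs : Measurable (history q' T) := measurable_history fun i _ => h.measurable_output i
  have h_event : ∀ b, MeasurableSet (history q' T ⁻¹' {b}) := fun b =>
    h_outputs (measurableSet_singleton b)
  have h_weighted : Measurable fun ω => g (x T ω) * pathWeight P f ch x w q q' T ω :=
    (hg.comp (h.measurable_state hf T)).mul (h.measurable_pathWeight hf hf_diff hγe T)
  calc ∫⁻ ω, g (x T ω) * (massAt P (history q' T) ω * pathWeight P f ch x w q q' T ω) ∂P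
      = ∑ b, P (history q' T ⁻¹' {b}) * ∫⁻ ω in history q' T ⁻¹' {b},
          g (x T ω) * pathWeight P f ch x w q q' T ω ∂P := by
        rw [lintegral_eq_sum_setLIntegral_preimage h_outputs]
        refine Finset.sum_congr rfl fun b _ => ?_
        rw [← lintegral_const_mul _ h_weighted]
        refine setLIntegral_congr_fun (h_event b) fun ω hω => ?_
        rw [massAt, show history q' T ω = b from hω, mul_left_comm]
    _ ≤ ∑ b, P (history q' T ⁻¹' {b}) * ∫⁻ y, g y := Finset.sum_le_sum fun b _ => mul_le_mul_right
        (h.setLIntegral_comp_state_mul_pathWeight_le hf hf_diff hf_inj hγe hx₀ b hg) _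
    _ = ∫⁻ y, g y := by
        rw [← Finset.sum_mul, sum_measure_preimage_singleton _ fun b _ => h_event b]
        simp only [Finset.coe_univ, Set.preimage_univ, measure_univ, one_mul]

lemma absolutelyContinuous_map_state (h : IsClosedLoop P f B ν ch γe γ x w q q')
    (hf : Measurable (Function.uncurry f)) (hf_diff : ∀ v, Differentiable ℝ fun y => f y v)
    (hf_inj : ∀ v, Function.Injective fun y => f y v)
    (hγe : ∀ t, Measurable (Function.uncurry (γe t))) (hx₀ : P.map (x 0) ≪ volume)
    (h_jac : ∀ᵐ ω ∂P, ∀ t ∈ Finset.range T, jacobian f (x t ω) (w t ω) ≠ 0) :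
    P.map (x T) ≪ volume := by
  refine Measure.AbsolutelyContinuous.mk fun A hA hA_null => ?_
  have h_le := h.lintegral_comp_state_mul_massAt_mul_pathWeight_le hf hf_diff hf_inj hγe hx₀
    (T := T) (g := A.indicator 1) (measurable_one.indicator hA)
  have h_meas : Measurable fun ω => A.indicator (1 : Vec N → ENNReal) (x T ω) *
      (massAt P (history q' T) ω * pathWeight P f ch x w q q' T ω) :=
    ((measurable_one.indicator hA).comp (h.measurable_state hf T)).mul
      (h.measurable_massAt_mul_pathWeight hf hf_diff hγe T)
  rw [lintegral_indicator_one hA, hA_null, nonpos_iff_eq_zero, lintegral_eq_zero_iff h_meas] at h_le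
  rw [Measure.map_apply (h.measurable_state hf T) hA, measure_eq_zero_iff_ae_notMem]
  filter_upwards [h_le, h_jac, ae_massAt_ne_zero (P := P) (history q' T),
    ae_densityAt_ne_zero_and_ne_top h.measurable_init hx₀] with ω h_zero h_jac h_mass h_density hω
  refine mul_ne_zero h_mass (pathWeight_ne_zero (ch := ch) (q := q) (q' := q') h_density.2 h_jac) ?_
  simpa only [Set.indicator_of_mem (show x T ω ∈ A from hω), Pi.one_apply, one_mul,
    Pi.zero_apply] using h_zero

lemma lintegral_likelihoodRatio_le_one (h : IsClosedLoop P f B ν ch γe γ x w q q')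
    (hf : Measurable (Function.uncurry f)) (hf_diff : ∀ v, Differentiable ℝ fun y => f y v)
    (hf_inj : ∀ v, Function.Injective fun y => f y v)
    (hγe : ∀ t, Measurable (Function.uncurry (γe t))) (hx₀ : P.map (x 0) ≪ volume) :
    ∫⁻ ω, likelihoodRatio P f ch x w q q' T ω ∂P ≤ 1 :=
  calc ∫⁻ ω, likelihoodRatio P f ch x w q q' T ω ∂P
      ≤ ∫⁻ y, (P.map (x T)).rnDeriv volume y :=
        h.lintegral_comp_state_mul_massAt_mul_pathWeight_le hf hf_diff hf_inj hγe hx₀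
          (Measure.measurable_rnDeriv _ _)
    _ ≤ P.map (x T) Set.univ := Measure.lintegral_rnDeriv_le
    _ = 1 := by
        rw [Measure.map_apply (h.measurable_state hf T) MeasurableSet.univ, Set.preimage_univ,
          measure_univ]

end ChangeOfMeasure

section EntropyInequality

variable {N d s : ℕ} {M M' : Type*} [Fintype M] [MeasurableSpace M] [MeasurableSingletonClass M]
  [Fintype M'] [MeasurableSpace M'] [MeasurableSingletonClass M']
  {Ω : Type*} [MeasurableSpace Ω] {P : Measure Ω} [IsProbabilityMeasure P]
  {f : Vec N → Vec d → Vec N}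
  {B : Matrix (Fin N) (Fin s) ℝ} {ν : Measure (Vec d)} {ch : Channel M M'}
  {γe : CodingPolicy N M M'} {γ : ControlPolicy s M'} {x : ℕ → Ω → Vec N} {w : ℕ → Ω → Vec d}
  {q : ℕ → Ω → M} {q' : ℕ → Ω → M'} {T : ℕ}

lemma sum_extIntegral_log2Abs_jacobian_add_le
    (h : IsClosedLoop P f B ν ch γe γ x w q q')
    (hf : Measurable (Function.uncurry f)) (hf_diff : ∀ v, Differentiable ℝ fun y => f y v)
    (hf_inj : ∀ v, Function.Injective fun y => f y v)
    (hγe : ∀ t, Measurable (Function.uncurry (γe t))) (hx₀ : P.map (x 0) ≪ volume)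
    (h_jac : ∀ᵐ ω ∂P, ∀ t ∈ Finset.range T, jacobian f (x t ω) (w t ω) ≠ 0) :
    extIntegral P (fun ω => ∑ t ∈ Finset.range T, log2Abs (jacobian f (x t ω) (w t ω)) +
        ((-Real.logb 2 (densityAt P (x 0) ω).toReal : ℝ) : EReal)) ≤
      diffEntropy (P.map (x T)) + (directedInfo P q q' T : ℝ) := by
  have hx_T := h.absolutelyContinuous_map_state hf hf_diff hf_inj hγe hx₀ h_jac
  have h_ratio := (h.measurable_likelihoodRatio (T := T) hf hf_diff hγe).aemeasurable (μ := P)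
  have h_ratio_le := h.lintegral_likelihoodRatio_le_one (T := T) hf hf_diff hf_inj hγe hx₀
  have h_info_int : Integrable (directedInfoDensity P ch q q' T) P :=
    integrable_directedInfoDensity (h.measurable_input hf hγe) h.measurable_output T
  have h_gap_int : Integrable (fun ω =>
      ((likelihoodRatio P f ch x w q q' T ω).toReal - 1) / Real.log 2) P :=
    integrable_toReal_sub_one_div h_ratio h_ratio_le _
  have h_entropy := (measurable_neg_logb_densityAt (P := P) (h.measurable_state hf T)).aemeasurable
    (μ := P)
  calc extIntegral P (fun ω => ∑ t ∈ Finset.range T, log2Abs (jacobian f (x t ω) (w t ω)) +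
        ((-Real.logb 2 (densityAt P (x 0) ω).toReal : ℝ) : EReal))
      ≤ extIntegral P fun ω => ((-Real.logb 2 (densityAt P (x T) ω).toReal : ℝ) : EReal) +
          ((directedInfoDensity P ch q q' T ω +
            ((likelihoodRatio P f ch x w q q' T ω).toReal - 1) / Real.log 2 : ℝ) : EReal) := by
        refine extIntegral_mono_ae ?_
        filter_upwards [h_jac, ae_massAt_ne_zero (P := P) (history q' T),
          ae_densityAt_ne_zero_and_ne_top h.measurable_init hx₀,
          ae_densityAt_ne_zero_and_ne_top (h.measurable_state hf T) hx_T,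
          ae_all_iff.2 (h.ae_channelProb_ne_zero hf hγe)]
          with ω h_jac h_mass h_density₀ h_density h_ch
        exact sum_log2Abs_jacobian_add_le h_mass h_density₀ h_density h_jac fun t _ => h_ch t
    _ ≤ diffEntropy (P.map (x T)) + (∫ ω, (directedInfoDensity P ch q q' T ω +
          ((likelihoodRatio P f ch x w q q' T ω).toReal - 1) / Real.log 2) ∂P : ℝ) := by
        rw [diffEntropy_map (h.measurable_state hf T) hx_T]
        exact extIntegral_add_coe_le h_entropy (h_info_int.add h_gap_int)
    _ ≤ diffEntropy (P.map (x T)) + (directedInfo P q q' T : ℝ) := by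
        rw [integral_add h_info_int h_gap_int, ← directedInfo_eq_integral
          (h.measurable_input hf hγe) h.measurable_output (h.measure_history_inter_output hf hγe)]
        refine add_le_add_right (EReal.coe_le_coe (add_le_of_nonpos_right ?_)) _
        exact integral_toReal_sub_one_div_nonpos h_ratio h_ratio_le (Real.log_nonneg one_le_two)

lemma sum_expLogJacobian_add_diffEntropy_le
    (h : IsClosedLoop P f B ν ch γe γ x w q q')
    (hf : Measurable (Function.uncurry f)) (hf_diff : ∀ v, Differentiable ℝ fun y => f y v)
    (hf_inj : ∀ v, Function.Injective fun y => f y v)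
    (hγe : ∀ t, Measurable (Function.uncurry (γe t))) (T : ℕ) :
    ∑ t ∈ Finset.range T, expLogJacobian f (P.map (x t)) ν + diffEntropy (P.map (x 0)) ≤
      diffEntropy (P.map (x T)) + (directedInfo P q q' T : ℝ) := by
  rcases eq_or_ne (diffEntropy (P.map (x 0))) ⊥ with h_bot | h_entropy_ne_bot
  · simp only [h_bot, EReal.add_bot, bot_le]
  rcases eq_or_ne (∑ t ∈ Finset.range T, expLogJacobian f (P.map (x t)) ν) ⊥
    with h_bot | h_sum_ne_bot
  · simp only [h_bot, EReal.bot_add, bot_le]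
  have hx₀ := absolutelyContinuous_of_diffEntropy_ne_bot h_entropy_ne_bot
  have h_log_jac := fun t => (h.measurable_log2Abs_jacobian hf hf_diff t).aemeasurable (μ := P)
  have h_density := (measurable_neg_logb_densityAt (P := P) h.measurable_init).aemeasurable (μ := P)
  have h_jac : ∀ᵐ ω ∂P, ∀ t ∈ Finset.range T, jacobian f (x t ω) (w t ω) ≠ 0 :=
    (Finset.eventually_all _).2 fun t ht =>
      h.ae_jacobian_ne_zero_of_expLogJacobian_ne_bot hf hf_diff hγe fun h_bot =>
        h_sum_ne_bot (by rw [← Finset.add_sum_erase _ _ ht, h_bot, EReal.bot_add])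
  simp only [h.expLogJacobian_eq_extIntegral hf hf_diff hγe]
  rw [diffEntropy_map h.measurable_init hx₀]
  calc _ ≤ extIntegral P (fun ω => ∑ t ∈ Finset.range T, log2Abs (jacobian f (x t ω) (w t ω))) +
          extIntegral P fun ω => ((-Real.logb 2 (densityAt P (x 0) ω).toReal : ℝ) : EReal) :=
        add_le_add_left (sum_extIntegral_le _ fun t _ => h_log_jac t) _
    _ ≤ _ := extIntegral_add_le (Finset.aemeasurable_fun_sum _ fun t _ => h_log_jac t) h_density
    _ ≤ _ := h.sum_extIntegral_log2Abs_jacobian_add_le hf hf_diff hf_inj hγe hx₀ h_jac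

end EntropyInequality

end IsClosedLoop

end BodeFormula

open BodeFormula in
theorem mainTheorem6_general {N d s : ℕ}
    {M M' : Type*} [Fintype M] [MeasurableSpace M] [MeasurableSingletonClass M]
    [Fintype M'] [MeasurableSpace M'] [MeasurableSingletonClass M']
    {Ω : Type*} [MeasurableSpace Ω] {P : Measure Ω} [IsProbabilityMeasure P]
    {f : Vec N → Vec d → Vec N} {B : Matrix (Fin N) (Fin s) ℝ} {ν : Measure (Vec d)}
    {ch : Channel M M'} {γe : CodingPolicy N M M'} {γ : ControlPolicy s M'}
    {x : ℕ → Ω → Vec N} {w : ℕ → Ω → Vec d} {q : ℕ → Ω → M} {q' : ℕ → Ω → M'}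
    (hf : Measurable (Function.uncurry f)) (hf_diff : ∀ v, Differentiable ℝ fun y => f y v)
    (hf_inj : ∀ v, Function.Injective fun y => f y v)
    (hγe : ∀ t, Measurable (Function.uncurry (γe t)))
    (hloop : IsClosedLoop P f B ν ch γe γ x w q q') (hx₀ : diffEntropy (P.map (x 0)) ≠ ⊥)
    (hgrowth : limsup (fun t : ℕ => diffEntropy (P.map (x t)) / (t : EReal)) atTop ≤ 0) :
    limsup (fun T : ℕ =>
        (∑ t ∈ Finset.range T, expLogJacobian f (P.map (x t)) ν) / (T : EReal)) atTop
      ≤ limsup (fun T : ℕ => ((directedInfo P q q' T : ℝ) : EReal) / (T : EReal)) atTop := by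
  obtain ⟨c, -, hc⟩ := EReal.lt_iff_exists_real_btwn.1 (bot_lt_iff_ne_bot.2 hx₀)
  exact limsup_div_natCast_le_of_add_le_add (fun T => (add_le_add_right hc.le _).trans
    (hloop.sum_expLogJacobian_add_diffEntropy_le hf hf_diff hf_inj hγe T)) hgrowth

theorem mainTheorem6 {N d s : ℕ}
    {M M' : Type*} [Fintype M] [MeasurableSpace M] [MeasurableSingletonClass M]
    [Fintype M'] [MeasurableSpace M'] [MeasurableSingletonClass M']
    {Ω : Type*} [MeasurableSpace Ω] (P : Measure Ω) [IsProbabilityMeasure P]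
    (f : BodeFormula.Vec N → BodeFormula.Vec d → BodeFormula.Vec N)
    (B : Matrix (Fin N) (Fin s) ℝ) (ν : Measure (BodeFormula.Vec d))
    (ch : BodeFormula.Channel M M') (γe : BodeFormula.CodingPolicy N M M')
    (γ : BodeFormula.ControlPolicy s M')
    (x : ℕ → Ω → BodeFormula.Vec N) (w : ℕ → Ω → BodeFormula.Vec d)
    (q : ℕ → Ω → M) (q' : ℕ → Ω → M')
    (hf : Measurable (Function.uncurry f))
    (hf_diff : ∀ v, ContDiff ℝ 1 fun y => f y v)
    (hf_inv : ∀ v, Function.Bijective fun y => f y v)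
    (hγe : ∀ t, Measurable (Function.uncurry (γe t)))
    (hloop : BodeFormula.IsClosedLoop P f B ν ch γe γ x w q q')
    (hx₀ : BodeFormula.diffEntropy (P.map (x 0)) ≠ ⊥ ∧
      BodeFormula.diffEntropy (P.map (x 0)) ≠ ⊤)
    (hgrowth : limsup (fun t : ℕ => BodeFormula.diffEntropy (P.map (x t)) / (t : EReal)) atTop
      ≤ 0) :
    limsup (fun T : ℕ =>
        (∑ t ∈ Finset.range T, BodeFormula.expLogJacobian f (P.map (x t)) ν) / (T : EReal)) atTop
      ≤ limsup (fun T : ℕ =>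
        ((BodeFormula.directedInfo P q q' T : ℝ) : EReal) / (T : EReal)) atTop :=
  mainTheorem6_general hf (fun v => (hf_diff v).differentiable one_ne_zero)
    (fun v => (hf_inv v).injective) hγe hloop hx₀.1 hgrowth
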